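/- **Setting.** Let $d\in\{2,3\}$ and $r\ge 1$. Let $\mathcal T_h$ be a conforming mesh of finitely many $d$-simplices, $\Omega\subset\mathbb R^d$ the interior of their union, $h$ the largest element diameter, and suppose that each element $T$ contains a ball of diameter $C_{SR}\operatorname{diam}T$, where $C_{SR}>0$. Let $V^h\subset H^1_0(\Omega)$ be the Lagrange finite element space of degree $r$ on $\mathcal T_h$ with zero values on $\partial\Omega$, and $\{\phi_l\}$ its nodal basis, indexed by the Lagrange nodes in $\Omega$ (the degrees of freedom). Let $A:\Omega\to\mathbb R^{d\times d}$ (symmetric) and $n:\Omega\to\mathbb R$ be measurable with $|\xi|^2\le A(x)\xi\cdot\xi\le a_{\max}|\xi|^2$ for all $\xi\in\mathbb R^d$ and $0<n_{\min}\le n(x)\le 1$ for almost every $x\in\Omega$, where $a_{\max}\ge1$ and $n_{\min}\le 1$. Let $k>0$ and let $C_{inv}\ge1$ be such that $\|\nabla v\|_{L^2(T)}\le C_{inv}k\|v\|_{L^2(T)}$ for all elements $T$ and all $v\in V^h$. Let $\Omega=\bigcup_{i=1}^N\Omega_i^c$, where each $\Omega_i^c$ is the interior of a union of elements, and let $\Lambda_c$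 be the largest number of indices $i$ for which $\Omega_i^c$ contains a common element. For $\Omega'=\Omega_i^c$ put $$b_i(u,v)=\int_{\Omega'}(A\nabla u\cdot\nabla v-k^2n\,uv)\,dx,\quad (u,v)_{1,k,\Omega'}=\int_{\Omega'}(A\nabla u\cdot\nabla v+k^2n\,uv)\,dx,\quad \|u\|_{1,k,\Omega'}^2=(u,u)_{1,k,\Omega'}.$$ Let $\widetilde V_i=\{v|_{\Omega_i^c}:v\in V^h\}$, let $\operatorname{dof}(\Omega_i^c)$ be the set of degrees of freedom $l$ with $\operatorname{supp}\phi_l\subseteq\overline{\Omega_i^c}$, let $\mu_l=\#\{i: l\in\operatorname{dof}(\Omega_i^c)\}$, and put, with $v_l$ the nodal value of $v$ at $l$, $$\Xi_i v=\sum_{l\in\operatorname{dof}(\Omega_i^c)}\mu_l^{-1}v_l\,\phi_l|_{\Omega_i^c},\qquad c_i(u,v)=(\Xi_iu,\Xi_iv)_{1,k,\Omega_i^c}\qquad(u,v\in\widetilde V_i).$$ With $n_i=\dim\widetilde V_i$ and $s_i=\dim\ker c_i$, let $p^i_1,\dots,p^i_{n_i-s_i}\in\widetilde V_i$ be $c_i$-orthonormal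 eigenfunctions, $b_i(p^i_m,v)=\lambda^i_m c_i(p^i_m,v)$ for all $v\in\widetilde V_i$, with $\lambda^i_1\le\dots\le\lambda^i_{n_i-s_i}$. Put $$C_{eig}=\Lambda_c^2n_{\min}^{-1}(a_{\max}C_{inv}^2+2)^2,\qquad C_*=C_{eig}C_{inv}^2 .$$ Finally, $\Omega_i^c$ has *boundary-layer constant* $L\in\mathbb N$ if from each element in $\Omega_i^c$ one can pass, in at most $L$ steps through common facets of elements in $\Omega_i^c$, to an element in $\Omega_i^c$ that has a Lagrange node which belongs to $\operatorname{dof}(\Omega_i^c)$ or lies on $\partial\Omega$. **Theorem.** There are constants $C_1,C_2>0$, depending only on $d$, $r$, $C_{SR}$ and $L$ (and so independent of $k$, $h$, $C_{inv}$, $\Lambda_c$, $a_{\max}$, $n_{\min}$ and the diameters of the subdomains), such that the following holds in the above setting for every $i$ for which $\Omega_i^c$ has boundary-layer constant $L$. Suppose $(kh)^2\le C_1$. Then $$b_i(v,v)\ge C_1h^{-2}\|v\|_{L^2(\Omega_i^c)}^2\qquad\text{for all }v\in\ker c_i ,$$ and if $m_i\ge1$, $m_i+1\le n_i-s_i$ and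 $\lambda^i_{m_i+1}>0$, then for all $v\in\widetilde V_i$ the function $w=v-\Pi_{m_i}v$, where $\Pi_{m_i}v=\sum_{m=1}^{m_i}c_i(v,p^i_m)\,p^i_m$, satisfies $$0\le b_i(w,w)\le C_2^2\,a_{\max}n_{\min}^{-1}C_*\,\|v\|_{1,k,\Omega_i^c}^2\qquad\text{and}\qquad c_i(w,w)\le(\lambda^i_{m_i+1})^{-1}\,b_i(w,w).$$ -/

import Mathlib

open MeasureTheory

noncomputable section

namespace HkGenEO

/-- The ambient space `ℝ^d` with its Euclidean norm. -/
abbrev Pt (d : ℕ) : Type := EuclideanSpace ℝ (Fin d)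

/-! ### Simplicial meshes -/

/-- A conforming simplicial mesh in `ℝ^d`: a finite, nonempty geometric simplicial complex
(any two simplices meet in a common face) all of whose faces belong to `d`-dimensional simplices.
A simplex is recorded by its finite set of vertices. -/
structure Mesh (d : ℕ) where
  cplx : Geometry.SimplicialComplex ℝ (Pt d)
  finite_faces : cplx.faces.Finite
  nonempty_faces : cplx.faces.Nonempty
  pure_faces : ∀ s ∈ cplx.faces, ∃ t ∈ cplx.faces, s ⊆ t ∧ t.card = d + 1

namespace Mesh

variable {d : ℕ} (M : Mesh d)

/-- The closed simplex with vertex set `T`. -/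
def cell (T : Finset (Pt d)) : Set (Pt d) := convexHull ℝ (T : Set (Pt d))

/-- The elements of the mesh (as vertex sets): its `d`-dimensional simplices. -/
def elements : Finset (Finset (Pt d)) :=
  M.finite_faces.toFinset.filter fun T => T.card = d + 1

/-- The domain `Ω` that is meshed: the interior of the union of all closed elements. -/
def domain : Set (Pt d) := interior M.cplx.space

/-- The mesh size `h`, the largest diameter of an element. -/
def meshSize : ℝ := ⨆ T : {T // T ∈ M.elements}, Metric.diam (cell T.1)

/-- Shape regularity with constant `σ`: each element `T` contains a ball of diameter
`σ * diam T`, that is, the largest inscribed ball has diameter at least `σ * diam T`. -/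
def ShapeRegular (σ : ℝ) : Prop :=
  ∀ T ∈ M.elements, ∃ x, Metric.closedBall x (σ * Metric.diam (cell T) / 2) ⊆ cell T

/-! ### Barycentric coordinates and Lagrange elements -/

/-- `w` is the system of barycentric coordinates of the point `y` in the mesh: positive weights on
the vertices of one face, zero on all other points, of sum one and with barycentre `y`. -/
def IsBary (y : Pt d) (w : Pt d →₀ ℝ) : Prop :=
  w.support ∈ M.cplx.faces ∧ (∀ x, 0 ≤ w x) ∧ (w.sum fun _ c => c) = 1 ∧
    (w.sum fun x c => c • x) = y

open Classical in
/-- The barycentric coordinates of `y` (zero if `y` is not in the meshed region).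
As a function of `y`, `M.bary y x` is the piecewise linear hat function of the vertex `x`. -/
def bary (y : Pt d) : Pt d →₀ ℝ :=
  if h : ∃ w, M.IsBary y w then h.choose else 0

/-- Barycentric coordinates are unique, so that `bary` is well defined. -/
lemma isBary_unique {y : Pt d} {w w' : Pt d →₀ ℝ} (h : M.IsBary y w) (h' : M.IsBary y w') :
    w = w' := by
  classical
  have main : ∀ {u u' : Pt d →₀ ℝ}, M.IsBary y u → M.IsBary y u' → u.support ⊆ u'.support := by
    rintro u u' ⟨h1, h2, h3, h4⟩ ⟨g1, g2, g3, g4⟩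
    have hy : y ∈ convexHull ℝ (u.support : Set (Pt d)) := by
      rw [Finset.convexHull_eq]
      refine ⟨u, fun x _ => h2 x, h3, ?_⟩
      rw [Finset.centerMass_eq_of_sum_1 _ _ h3]; exact h4
    have hy' : y ∈ convexHull ℝ (u'.support : Set (Pt d)) := by
      rw [Finset.convexHull_eq]
      refine ⟨u', fun x _ => g2 x, g3, ?_⟩
      rw [Finset.centerMass_eq_of_sum_1 _ _ g3]; exact g4
    have hi := M.cplx.inter_subset_convexHull h1 g1 ⟨hy, hy'⟩
    rw [← Finset.coe_inter, Finset.convexHull_eq] at hi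
    obtain ⟨c, c0, c1, c2⟩ := hi
    rw [Finset.centerMass_eq_of_sum_1 _ _ c1] at c2
    have ind := affineIndependent_iff.1 (M.cplx.indep h1)
    let c' : Pt d → ℝ := fun x => if x ∈ u.support ∩ u'.support then c x else 0
    have e1 : ∑ x ∈ u.support, c' x = 1 := by
      rw [← c1, Finset.sum_ite_mem, ← Finset.inter_assoc, Finset.inter_self]
    have e2 : ∑ x ∈ u.support, c' x • x = y := by
      rw [← c2]
      simp only [c', ite_smul, zero_smul, Finset.sum_ite_mem]
      rw [← Finset.inter_assoc, Finset.inter_self]; rfl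
    intro x hx
    by_contra hx'
    have := ind Finset.univ (fun z => u z - c' z) ?_ ?_ ⟨x, hx⟩ (Finset.mem_univ _)
    · have hc : c' x = 0 := by simp only [c']; rw [if_neg]; simp [hx']
      rw [hc, sub_zero] at this
      exact (Finsupp.mem_support_iff.1 hx) this
    · rw [Finset.univ_eq_attach, Finset.sum_attach u.support (fun z => u z - c' z),
        Finset.sum_sub_distrib, e1, sub_eq_zero]; exact h3
    · rw [Finset.univ_eq_attach, Finset.sum_attach u.support (fun z => (u z - c' z) • z)]
      simp only [sub_smul]
      rw [Finset.sum_sub_distrib, e2, sub_eq_zero]; exact h4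
  have hs : w.support = w'.support := (main h h').antisymm (main h' h)
  have ind := affineIndependent_iff.1 (M.cplx.indep h.1)
  obtain ⟨h1, h2, h3, h4⟩ := h
  obtain ⟨g1, g2, g3, g4⟩ := h'
  rw [Finsupp.sum, ← hs] at g3 g4
  ext x
  by_cases hx : x ∈ w.support
  · have := ind Finset.univ (fun z => w z - w' z) ?_ ?_ ⟨x, hx⟩ (Finset.mem_univ _)
    · exact sub_eq_zero.1 this
    · rw [Finset.univ_eq_attach, Finset.sum_attach w.support (fun z => w z - w' z),
        Finset.sum_sub_distrib, g3, sub_eq_zero]; exact h3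
    · rw [Finset.univ_eq_attach, Finset.sum_attach w.support (fun z => (w z - w' z) • z)]
      simp only [sub_smul]
      rw [Finset.sum_sub_distrib, g4, sub_eq_zero]; exact h4
  · rw [Finsupp.notMem_support_iff.1 hx, Finsupp.notMem_support_iff.1 (hs ▸ hx)]

lemma bary_eq {y : Pt d} {w : Pt d →₀ ℝ} (h : M.IsBary y w) : M.bary y = w := by
  have hex : ∃ w, M.IsBary y w := ⟨w, h⟩
  rw [bary, dif_pos hex]
  exact M.isBary_unique hex.choose_spec h

open Classical in
/-- All vertices of the mesh. -/
def vertices : Finset (Pt d) := M.finite_faces.toFinset.biUnion id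

open Classical in
/-- The Lagrange nodes of degree `r`, written as multi-indices: `α` assigns multiplicities of sum
`r` to the vertices of one face, and stands for the point `∑ x, (α x / r) • x`. -/
def nodes (r : ℕ) : Finset (Pt d →₀ ℕ) :=
  (M.vertices.finsuppAntidiag r).filter fun α => α.support ∈ M.cplx.faces

/-- The position in `ℝ^d` of the Lagrange node `α` of degree `r`. -/
def nodePos (r : ℕ) (α : Pt d →₀ ℕ) : Pt d := α.sum fun x m => ((m : ℝ) / (r : ℝ)) • x

open Classical in
/-- The degrees of freedom: Lagrange nodes in the open domain `Ω` (homogeneous Dirichlet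
condition on `∂Ω`). -/
def dofs (r : ℕ) : Finset (Pt d →₀ ℕ) :=
  (M.nodes r).filter fun α => nodePos r α ∈ M.domain

/-- The Lagrange nodal basis function of degree `r` at the node `α`, extended by zero outside the
mesh. In terms of the barycentric coordinates `λ_x` it is the product over the vertices `x` of
`∏ j < α x, (r λ_x - j) / (j + 1)`. On each element it is a polynomial of degree at most `r`; it
takes the value `1` at the node `α` and `0` at every other node. -/
def basisFun (r : ℕ) (α : Pt d →₀ ℕ) (y : Pt d) : ℝ :=
  ∏ x ∈ α.support, ∏ j ∈ Finset.range (α x),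
    ((r : ℝ) * M.bary y x - (j : ℝ)) / ((j : ℝ) + 1)

lemma bary_node {r : ℕ} (hr : 1 ≤ r) {α : Pt d →₀ ℕ} (hα : α ∈ M.nodes r) (x : Pt d) :
    M.bary (nodePos r α) x = (α x : ℝ) / r := by
  classical
  have hr0 : (r : ℝ) ≠ 0 := by positivity
  obtain ⟨h1, h2⟩ := Finset.mem_filter.1 hα
  have hsum := (Finset.mem_finsuppAntidiag'.1 h1).1
  let w : Pt d →₀ ℝ := α.mapRange (fun m : ℕ => (m : ℝ) / r) (by simp)
  have hsup : w.support = α.support := by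
    ext z; simp [w]; omega
  have : M.IsBary (nodePos r α) w := by
    refine ⟨hsup ▸ h2, fun z => by simp [w]; positivity, ?_, ?_⟩
    · rw [Finsupp.sum_mapRange_index (by simp), Finsupp.sum, ← Finset.sum_div]
      rw [div_eq_one_iff_eq hr0]
      rw [← hsum]; simp [Finsupp.sum]
    · rw [Finsupp.sum_mapRange_index (by simp)]; rfl
  rw [M.bary_eq this]; simp [w]

/-- The nodal property `φ_α(β) = δ_{αβ}` of the basis functions. -/
lemma basisFun_node {r : ℕ} (hr : 1 ≤ r) {α β : Pt d →₀ ℕ} (hα : α ∈ M.nodes r)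
    (hβ : β ∈ M.nodes r) : M.basisFun r α (nodePos r β) = if α = β then 1 else 0 := by
  classical
  have hr0 : (r : ℝ) ≠ 0 := by positivity
  have key : M.basisFun r α (nodePos r β) =
    ∏ x ∈ α.support, ∏ j ∈ Finset.range (α x), (((β x : ℝ)) - j) / (j + 1) := by
    unfold basisFun
    refine Finset.prod_congr rfl fun x _ => Finset.prod_congr rfl fun j _ => ?_
    rw [M.bary_node hr hβ]; field_simp
  rw [key]
  have sa := (Finset.mem_finsuppAntidiag'.1 (Finset.mem_filter.1 hα).1).1
  have sb := (Finset.mem_finsuppAntidiag'.1 (Finset.mem_filter.1 hβ).1).1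
  split_ifs with hab
  · subst hab
    refine Finset.prod_eq_one fun x _ => ?_
    rw [Finset.prod_div_distrib, ← Finset.prod_range_reflect]
    rw [div_eq_one_iff_eq (Finset.prod_ne_zero_iff.2 fun j _ => by positivity)]
    refine Finset.prod_congr rfl fun j hj => ?_
    have := Finset.mem_range.1 hj
    rw [Nat.cast_sub (by omega), Nat.cast_sub (by omega)]; push_cast; ring
  · have : ∃ x, β x < α x := by
      by_contra! hle
      apply hab
      have hle' : α ≤ β := hle
      obtain ⟨γ, rfl⟩ := exists_add_of_le hle'
      rw [Finsupp.sum_add_index' (by simp) (by simp), sa] at sb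
      have h0 : (γ.sum fun _ m => m) = 0 := by
        have : (γ.sum fun _ m => m) + r = r := by rw [add_comm]; exact sb
        omega
      have : γ = 0 := by
        ext z
        by_contra hz
        have hz' : z ∈ γ.support := Finsupp.mem_support_iff.2 hz
        exact hz ((Finset.sum_eq_zero_iff.1 h0) z hz')
      simp [this]
    obtain ⟨x, hx⟩ := this
    refine Finset.prod_eq_zero (i := x) (Finsupp.mem_support_iff.2 (by omega)) ?_
    exact Finset.prod_eq_zero (i := β x) (Finset.mem_range.2 hx) (by simp)

/-- The conforming Lagrange finite element space `V^h ⊆ H^1_0(Ω)` of degree `r` (functions on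
`ℝ^d` that vanish outside `Ω`): the span of the nodal basis functions at the nodes in `Ω`. -/
def femSpace (r : ℕ) : Submodule ℝ (Pt d → ℝ) :=
  Submodule.span ℝ {f | ∃ α ∈ M.dofs r, f = M.basisFun r α}

/-! ### Subdomains -/

/-- The open subdomain `Ω' ⊆ Ω` composed of the elements in `S`. -/
def subdomain (S : Finset (Finset (Pt d))) : Set (Pt d) := interior (⋃ T ∈ S, cell T)

/-- Restriction of finite element functions to (the closure of) a set `Ω'`. A function on the
closure of `Ω'` is represented by its extension by zero. -/
def restrict (Ω' : Set (Pt d)) : (Pt d → ℝ) →ₗ[ℝ] (Pt d → ℝ) where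
  toFun f := (closure Ω').indicator f
  map_add' f g := Set.indicator_add' _ f g
  map_smul' c f := Set.indicator_const_smul _ c f

/-- The space `Ṽ_{Ω'}` of all restrictions `v|_{Ω'}`, `v ∈ V^h`. -/
def restrictedSpace (r : ℕ) (Ω' : Set (Pt d)) : Submodule ℝ (Pt d → ℝ) :=
  (M.femSpace r).map (restrict Ω')

open Classical in
/-- `dof(Ω')`: the degrees of freedom whose basis function is supported in the closure of `Ω'`. -/
def innerDofs (r : ℕ) (Ω' : Set (Pt d)) : Finset (Pt d →₀ ℕ) :=
  (M.dofs r).filter fun α => tsupport (M.basisFun r α) ⊆ closure Ω'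

/-- `S 0, …, S (N-1)` is a cover of `Ω` by (open) subdomains composed of elements. -/
def IsCover {N : ℕ} (S : Fin N → Finset (Finset (Pt d))) : Prop :=
  (∀ i, S i ⊆ M.elements) ∧ M.domain = ⋃ i, subdomain (S i)

open Classical in
/-- `Λ_c`: the largest number of subdomains of the cover that contain a given element. -/
def overlapNumber {N : ℕ} (S : Fin N → Finset (Finset (Pt d))) : ℕ :=
  M.elements.sup fun T => (Finset.univ.filter fun i => T ∈ S i).card

open Classical in
/-- `μ_α`: the number of subdomains of the cover for which `α` is an internal degree of freedom. -/
def multiplicity (r : ℕ) {N : ℕ} (S : Fin N → Finset (Finset (Pt d))) (α : Pt d →₀ ℕ) : ℕ :=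
  (Finset.univ.filter fun i => α ∈ M.innerDofs r (subdomain (S i))).card

/-- The partition of unity operator
`Ξ_i v = ∑ α ∈ dof(Ω_i), (1 / μ_α) * v_α * φ_α|_{Ω_i}`, where `v_α` is the nodal value. -/
def Xi (r : ℕ) {N : ℕ} (S : Fin N → Finset (Finset (Pt d))) (i : Fin N) (v : Pt d → ℝ) :
    Pt d → ℝ :=
  ∑ α ∈ M.innerDofs r (subdomain (S i)),
    ((1 / (M.multiplicity r S α : ℝ)) * v (nodePos r α)) •
      restrict (subdomain (S i)) (M.basisFun r α)

open Classical in
/-- Quantitative thickness of the subdomain composed of `S`: from each of its elements one reaches,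
in at most `L` steps inside `S` across common facets, an element with a Lagrange node that is an
internal degree of freedom of the subdomain or lies on `∂Ω`. -/
def LayerBound (r : ℕ) (S : Finset (Finset (Pt d))) (L : ℕ) : Prop :=
  ∀ T ∈ S, ∃ j ≤ L, ∃ τ : ℕ → Finset (Pt d),
    τ 0 = T ∧ (∀ a ≤ j, τ a ∈ S) ∧ (∀ a < j, (τ a ∩ τ (a + 1)).card = d) ∧
    ∃ α ∈ M.nodes r, α.support ⊆ τ j ∧
      (α ∈ M.innerDofs r (subdomain S) ∨ nodePos r α ∈ frontier M.domain)

end Mesh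

/-! ### Bilinear forms and norms -/

variable {d : ℕ}

/-- The squared norm `‖v‖²` of `L²(Ω')`. -/
def l2Sq (Ω' : Set (Pt d)) (v : Pt d → ℝ) : ℝ := ∫ x in Ω', v x ^ 2

/-- The squared norm `‖∇v‖²` of `L²(Ω')`. (The finite element functions are differentiable outside
the null set formed by the boundaries of the elements.) -/
def gradSq (Ω' : Set (Pt d)) (v : Pt d → ℝ) : ℝ := ∫ x in Ω', ‖gradient v x‖ ^ 2

/-- `a_{Ω'}(u,v) = ∫_{Ω'} A ∇u · ∇v`. -/
def formA (A : Pt d → Matrix (Fin d) (Fin d) ℝ) (Ω' : Set (Pt d)) (u v : Pt d → ℝ) : ℝ :=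
  ∫ x in Ω', (A x).mulVec (gradient u x).ofLp ⬝ᵥ (gradient v x).ofLp

/-- `(u,v)_{n,Ω'} = ∫_{Ω'} n u v`. -/
def formN (n : Pt d → ℝ) (Ω' : Set (Pt d)) (u v : Pt d → ℝ) : ℝ :=
  ∫ x in Ω', n x * u x * v x

/-- `b_{Ω'}(u,v) = a_{Ω'}(u,v) - k² (u,v)_{n,Ω'}`. -/
def formB (A : Pt d → Matrix (Fin d) (Fin d) ℝ) (n : Pt d → ℝ) (k : ℝ) (Ω' : Set (Pt d))
    (u v : Pt d → ℝ) : ℝ :=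
  formA A Ω' u v - k ^ 2 * formN n Ω' u v

/-- The inner product `(u,v)_{1,k,Ω'} = a_{Ω'}(u,v) + k² (u,v)_{n,Ω'}`. -/
def inner1k (A : Pt d → Matrix (Fin d) (Fin d) ℝ) (n : Pt d → ℝ) (k : ℝ) (Ω' : Set (Pt d))
    (u v : Pt d → ℝ) : ℝ :=
  formA A Ω' u v + k ^ 2 * formN n Ω' u v

/-- The induced norm `‖v‖_{1,k,Ω'}`. -/
def norm1k (A : Pt d → Matrix (Fin d) (Fin d) ℝ) (n : Pt d → ℝ) (k : ℝ) (Ω' : Set (Pt d))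
    (v : Pt d → ℝ) : ℝ :=
  √(inner1k A n k Ω' v v)

/-- The assumptions on the coefficients, normalised so that `a_min = 1` and `n_max = 1`. -/
structure CoefficientBounds (Ω : Set (Pt d)) (A : Pt d → Matrix (Fin d) (Fin d) ℝ)
    (n : Pt d → ℝ) (aMax nMin : ℝ) : Prop where
  measurable_A : ∀ i j, Measurable fun x => A x i j
  measurable_n : Measurable n
  symm_A : ∀ᵐ x ∂volume.restrict Ω, (A x).IsSymm
  bounds_A : ∀ᵐ x ∂volume.restrict Ω, ∀ ξ : Pt d,
    ‖ξ‖ ^ 2 ≤ (A x).mulVec ξ.ofLp ⬝ᵥ ξ.ofLp ∧ (A x).mulVec ξ.ofLp ⬝ᵥ ξ.ofLp ≤ aMax * ‖ξ‖ ^ 2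
  bounds_n : ∀ᵐ x ∂volume.restrict Ω, nMin ≤ n x ∧ n x ≤ 1
  one_le_aMax : 1 ≤ aMax
  nMin_pos : 0 < nMin
  nMin_le_one : nMin ≤ 1

/-- The inverse estimate `‖∇v‖_T ≤ Cinv k ‖v‖_T` for all elements `T` and all `v ∈ V^h`. -/
def InverseEstimate (M : Mesh d) (r : ℕ) (k Cinv : ℝ) : Prop :=
  ∀ T ∈ M.elements, ∀ v ∈ M.femSpace r,
    √(gradSq (Mesh.cell T) v) ≤ Cinv * k * √(l2Sq (Mesh.cell T) v)

/-! ### The local generalised eigenvalue problem -/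

section GEVP

variable (M : Mesh d) (r : ℕ) {N : ℕ} (S : Fin N → Finset (Finset (Pt d))) (i : Fin N)
  (A : Pt d → Matrix (Fin d) (Fin d) ℝ) (n : Pt d → ℝ) (k : ℝ)

/-- The local space `Ṽ_i`. -/
def localSpace : Submodule ℝ (Pt d → ℝ) := M.restrictedSpace r (Mesh.subdomain (S i))

/-- `b_i`, the form `b` on the subdomain `Ω_i`. -/
def bLoc (u v : Pt d → ℝ) : ℝ := formB A n k (Mesh.subdomain (S i)) u v

/-- `c_i(u,v) = (Ξ_i u, Ξ_i v)_{1,k,Ω_i}`. -/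
def cLoc (u v : Pt d → ℝ) : ℝ :=
  inner1k A n k (Mesh.subdomain (S i)) (M.Xi r S i u) (M.Xi r S i v)

/-- `ker c_i`. -/
def kerC : Set (Pt d → ℝ) :=
  {v | v ∈ localSpace M r S i ∧ ∀ w ∈ localSpace M r S i, cLoc M r S i A n k v w = 0}

/-- `n_i - s_i`, the number of finite eigenvalues, where `n_i = dim Ṽ_i` and
`s_i = dim ker c_i`. -/
def numFinite : ℕ :=
  Module.finrank ℝ (localSpace M r S i) - Set.finrank ℝ (kerC M r S i A n k)

/-- `p` is a full system of `c_i`-orthonormal eigenfunctions of the problem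
`b_i(p,v) = lam c_i(p,v)` for all `v ∈ Ṽ_i`, with its finite eigenvalues `lam` in nondecreasing
order (indices start at `0`: the `m`-th eigenpair of the text is the one of index `m - 1`). -/
structure IsEigensystem (p : Fin (numFinite M r S i A n k) → Pt d → ℝ)
    (lam : Fin (numFinite M r S i A n k) → ℝ) : Prop where
  mem : ∀ j, p j ∈ localSpace M r S i
  eigen : ∀ j, ∀ v ∈ localSpace M r S i,
    bLoc S i A n k (p j) v = lam j * cLoc M r S i A n k (p j) v
  orthonormal : ∀ j j', cLoc M r S i A n k (p j) (p j') = if j = j' then 1 else 0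
  monotone : Monotone lam

/-- The local projector `Π_m v = ∑ j ≤ m, c_i(v, p_j) p_j` onto the first `m` eigenfunctions. -/
def proj (p : Fin (numFinite M r S i A n k) → Pt d → ℝ) (m : ℕ) (v : Pt d → ℝ) : Pt d → ℝ :=
  ∑ j ∈ Finset.univ.filter (fun j : Fin (numFinite M r S i A n k) => (j : ℕ) < m),
    cLoc M r S i A n k v (p j) • p j

end GEVP

/-- `C_eig = Λ_c² n_min⁻¹ (a_max C_inv² + 2)²`. -/
def Ceig (Lam : ℕ) (aMax nMin Cinv : ℝ) : ℝ :=
  (Lam : ℝ) ^ 2 * nMin⁻¹ * (aMax * Cinv ^ 2 + 2) ^ 2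

/-- `C_* = C_eig C_inv²`. -/
def Cstar (Lam : ℕ) (aMax nMin Cinv : ℝ) : ℝ := Ceig Lam aMax nMin Cinv * Cinv ^ 2

end HkGenEO

end

/-! The proof has three ingredients.

Positivity on the kernel. If c_i(v,v) = 0, then Ξ_i v = 0, so v vanishes at every internal degree of
freedom; it also vanishes at the nodes on ∂Ω. By the layer condition every element is joined, by a
chain of at most L facet neighbours, to an element on which v has a zero. On one element, finite
dimensionality and scaling bound the oscillation of a polynomial by the L² norm of its gradient;
adding oscillations along the chain bounds v on the first element. Facet neighbours share an edge,
so shape regularity makes the diameters along a chain comparable, and a volume count shows that each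
element is near boundedly many starting elements. Summation gives ‖v‖² ≤ C h² ‖∇v‖²
(`exists_poincare`). If (kh)² ≤ 1/(4C), then k² ∫ n v² is at most a quarter of ‖∇v‖², so b_i(v,v)
controls both h⁻²‖v‖² and half of ‖v‖²_{1,k} (`coercive_of_poincare`).

Stability of nodal operations. On one element the nodal values and the L² norm of a finite element
function control each other; the inverse estimate turns this into stability in ‖·‖_{1,k}
(`exists_inner1k_le_of_nodal`). It is used twice: Ξ_i is bounded, so c_i ≤ K₂ ‖·‖²_{1,k}
(`cLoc_le_inner1k`); and every v differs by an element of ker c_i from its truncation q to the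
internal degrees of freedom, where ‖q‖²_{1,k} ≤ K₁ c_i(v,v) because μ_l ≤ Λ_c (`exists_nodal_part`).

Linear algebra (`eigenprojection_bounds`). The eigenfunctions span a complement of ker c_i,
orthogonal to it for both b and c. Write v = u + P + R with u in the kernel, P = Π_m v and R the
remaining modes. Then w = u + R, and b(w,w) is b(u,u) plus the sum of λ_j t_j² over the remaining
modes; this gives nonnegativity and the bound on c(w,w). Moreover b(w,w) = b(v,v) - b(P,P), and the
only difficulty is that b(P,P) may be negative. Split P = q + z with q its nodal truncation and z in
the kernel. Since b(P,z) = 0, coercivity at z and Young's inequality give -b(P,P) ≤ 3‖q‖²_{1,k} ≤ 3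
K₁ c(P,P) ≤ 3 K₁ K₂ ‖v‖²_{1,k}. -/

noncomputable section

namespace HkGenEO

section Polynomials

/-! ### Polynomials and their estimates on balls -/

/-! ### From kernel inclusions to norm bounds in finite dimension. -/

section FiniteDimensional

variable {V E F : Type*} [AddCommGroup V] [Module ℝ V] [FiniteDimensional ℝ V]
  [NormedAddCommGroup E] [NormedSpace ℝ E] [NormedAddCommGroup F]

/-- `Φ` factors through the range of `Ψ`, and a linear map on that finite-dimensional range is
bounded. -/
lemma exists_norm_le_of_ker_le [NormedSpace ℝ F] (Φ : V →ₗ[ℝ] E) (Ψ : V →ₗ[ℝ] F)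
    (h : LinearMap.ker Ψ ≤ LinearMap.ker Φ) : ∃ C ≥ 0, ∀ v, ‖Φ v‖ ≤ C * ‖Ψ v‖ := by
  let G : LinearMap.range Ψ →ₗ[ℝ] E :=
    ((LinearMap.ker Ψ).liftQ Φ h).comp Ψ.quotKerEquivRange.symm.toLinearMap
  have hG : ∀ v, G ⟨Ψ v, LinearMap.mem_range_self Ψ v⟩ = Φ v := by
    intro v
    have : Ψ.quotKerEquivRange.symm ⟨Ψ v, LinearMap.mem_range_self Ψ v⟩ =
        Submodule.Quotient.mk v := by
      rw [LinearEquiv.symm_apply_eq]; rfl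
    simp [G, this]
  let G' := LinearMap.toContinuousLinearMap G
  refine ⟨‖G'‖, norm_nonneg G', fun v => ?_⟩
  rw [← hG v]
  exact G'.le_opNorm ⟨Ψ v, LinearMap.mem_range_self Ψ v⟩

lemma norm_toLp_sq [InnerProductSpace ℝ F] {X : Type*} [MeasurableSpace X] {μ : Measure X}
    {f : X → F} (hf : MemLp f 2 μ) : ‖hf.toLp f‖ ^ 2 = ∫ x, ‖f x‖ ^ 2 ∂μ := by
  rw [← real_inner_self_eq_norm_sq, L2.inner_def]
  refine integral_congr_ae ?_
  filter_upwards [hf.coeFn_toLp] with x hx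
  rw [hx, real_inner_self_eq_norm_sq]

/-- The previous bound with `Ψ` the class of `G v` in L². It reduces each polynomial inequality
below to a statement about polynomials with zero right-hand side. -/
lemma exists_sq_le_integral [InnerProductSpace ℝ F] {X : Type*} [MeasurableSpace X]
    {μ : Measure X} (Φ : V →ₗ[ℝ] E) (G : V →ₗ[ℝ] (X → F)) (hG : ∀ v, MemLp (G v) 2 μ)
    (h : ∀ v, (∫ x, ‖G v x‖ ^ 2 ∂μ) = 0 → Φ v = 0) :
    ∃ C ≥ 0, ∀ v, ‖Φ v‖ ^ 2 ≤ C * ∫ x, ‖G v x‖ ^ 2 ∂μ := by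
  let Ψ : V →ₗ[ℝ] Lp F 2 μ :=
    { toFun := fun v => (hG v).toLp
      map_add' := fun u v => by
        rw [← MemLp.toLp_add (hG u) (hG v)]; congr 1; exact map_add G u v
      map_smul' := fun c v => by
        rw [RingHom.id_apply, ← MemLp.toLp_const_smul c (hG v)]; congr 1; exact map_smul G c v }
  obtain ⟨C, hC, hle⟩ := exists_norm_le_of_ker_le Φ Ψ fun v hv => by
    refine h v ?_
    rw [← norm_toLp_sq (hG v)]
    have : (hG v).toLp = 0 := hv
    rw [this]; simp
  refine ⟨C ^ 2, by positivity, fun v => ?_⟩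
  rw [← norm_toLp_sq (hG v), ← mul_pow]
  exact pow_le_pow_left₀ (norm_nonneg _) (hle v) 2

end FiniteDimensional

/-! ### Affine functions and polynomials. -/

variable {d : ℕ}

/-- The affine functions on `ℝ^d`. -/
def affineFun (d : ℕ) : Submodule ℝ (Pt d → ℝ) :=
  LinearMap.range ({
    toFun := fun a y => a.1 + a.2 y
    map_add' := fun a b => by ext y; simp; ring
    map_smul' := fun c a => by ext y; simp; ring } :
      ℝ × Module.Dual ℝ (Pt d) →ₗ[ℝ] (Pt d → ℝ))

lemma mem_affineFun {f : Pt d → ℝ} :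
    f ∈ affineFun d ↔ ∃ (c : ℝ) (l : Module.Dual ℝ (Pt d)), ∀ y, f y = c + l y := by
  constructor
  · rintro ⟨a, rfl⟩; exact ⟨a.1, a.2, fun _ => rfl⟩
  · rintro ⟨c, l, h⟩; exact ⟨(c, l), funext fun y => (h y).symm⟩

lemma affineMap_mem_affineFun (g : Pt d →ᵃ[ℝ] ℝ) : (g : Pt d → ℝ) ∈ affineFun d :=
  mem_affineFun.2 ⟨g 0, g.linear, fun y => by
    conv_lhs => rw [AffineMap.decomp g]
    simp [add_comm]⟩

lemma const_mem_affineFun (c : ℝ) : (fun _ => c : Pt d → ℝ) ∈ affineFun d :=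
  mem_affineFun.2 ⟨c, 0, fun _ => by simp⟩

/-- The polynomial functions on `ℝ^d` of degree at most `r`. -/
def polySpace (d r : ℕ) : Submodule ℝ (Pt d → ℝ) := affineFun d ^ r

instance (d r : ℕ) : FiniteDimensional ℝ (polySpace d r) := by
  have : (affineFun d).FG := Module.Finite.iff_fg.1 (by unfold affineFun; infer_instance)
  exact Module.Finite.iff_fg.2 (this.pow r)

lemma polySpace_succ (r : ℕ) : polySpace d (r + 1) = polySpace d r * affineFun d :=
  pow_succ _ _

lemma polySpace_induction {C : (Pt d → ℝ) → Prop} (h1 : ∀ c : ℝ, C fun _ => c)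
    (hadd : ∀ f g, C f → C g → C (f + g)) (hmul : ∀ f, C f → ∀ g ∈ affineFun d, C (f * g))
    (r : ℕ) : ∀ P ∈ polySpace d r, C P := by
  induction r with
  | zero =>
    intro P hP
    rw [polySpace, pow_zero, Submodule.mem_one] at hP
    obtain ⟨c, rfl⟩ := hP
    exact h1 c
  | succ r ih =>
    intro P hP
    rw [polySpace_succ] at hP
    exact Submodule.mul_induction_on hP (fun f hf g hg => hmul f (ih f hf) g hg)
      fun f g hf hg => hadd f g hf hg

lemma contDiff_of_mem_affineFun {g : Pt d → ℝ} (hg : g ∈ affineFun d) {m : WithTop ℕ∞} :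
    ContDiff ℝ m g := by
  obtain ⟨c, l, h⟩ := mem_affineFun.1 hg
  rw [funext h]
  exact contDiff_const.add (LinearMap.toContinuousLinearMap l).contDiff

lemma contDiff_of_mem_polySpace {r : ℕ} {P : Pt d → ℝ} (hP : P ∈ polySpace d r)
    {m : WithTop ℕ∞} : ContDiff ℝ m P := by
  refine polySpace_induction (C := fun P => ContDiff ℝ m P) (fun c => contDiff_const)
    (fun f g hf hg => hf.add hg)
    (fun f hf g hg => hf.mul (contDiff_of_mem_affineFun hg)) r P hP

lemma comp_mem_polySpace {r : ℕ} {P : Pt d → ℝ} (hP : P ∈ polySpace d r) (c : Pt d) (h : ℝ) :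
    (fun y => P (c + h • y)) ∈ polySpace d r := by
  induction r generalizing P with
  | zero =>
    rw [polySpace, pow_zero, Submodule.mem_one] at hP ⊢
    obtain ⟨a, rfl⟩ := hP
    exact ⟨a, rfl⟩
  | succ r ih =>
    rw [polySpace_succ] at hP ⊢
    refine Submodule.mul_induction_on hP (fun f hf g hg => ?_) fun f g hf hg => add_mem hf hg
    refine Submodule.mul_mem_mul (ih hf) ?_
    obtain ⟨a, l, e⟩ := mem_affineFun.1 hg
    exact mem_affineFun.2 ⟨a + l c, h • l, fun y => by simp [e]; ring⟩

lemma continuous_gradient {P : Pt d → ℝ} (hP : ContDiff ℝ 1 P) : Continuous (gradient P) :=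
  (LinearIsometryEquiv.continuous _).comp (hP.continuous_fderiv one_ne_zero)

lemma gradient_add_apply {f g : Pt d → ℝ} {x : Pt d} (hf : DifferentiableAt ℝ f x)
    (hg : DifferentiableAt ℝ g x) : gradient (f + g) x = gradient f x + gradient g x := by
  simp [gradient, fderiv_add hf hg]

lemma gradient_smul_apply {f : Pt d → ℝ} {x : Pt d} (c : ℝ) (hf : DifferentiableAt ℝ f x) :
    gradient (c • f) x = c • gradient f x := by
  simp [gradient, fderiv_const_smul hf]

lemma gradient_zero_fun (x : Pt d) : gradient (0 : Pt d → ℝ) x = 0 := by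
  simp [gradient]

lemma eq_zero_of_setIntegral_ball_eq_zero {f : Pt d → ℝ} (hf : Continuous f) (h0 : ∀ x, 0 ≤ f x)
    {ρ : ℝ} (h : ∫ x in Metric.closedBall 0 ρ, f x = 0) : ∀ x ∈ Metric.ball 0 ρ, f x = 0 := by
  have hi : IntegrableOn f (Metric.closedBall 0 ρ) :=
    hf.continuousOn.integrableOn_compact (isCompact_closedBall _ _)
  rw [integral_eq_zero_iff_of_nonneg h0 hi] at h
  have h' : f =ᵐ[volume.restrict (Metric.ball 0 ρ)] fun _ => 0 :=
    ae_restrict_of_ae_restrict_of_subset Metric.ball_subset_closedBall h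
  exact Measure.eqOn_open_of_ae_eq h' Metric.isOpen_ball hf.continuousOn continuousOn_const

lemma eq_const_of_eqOn_ball {r : ℕ} {P : Pt d → ℝ} (hP : P ∈ polySpace d r) {ρ : ℝ} (hρ : 0 < ρ)
    {c : ℝ} (h : ∀ x ∈ Metric.ball (0 : Pt d) ρ, P x = c) (x : Pt d) : P x = c := by
  -- At the smoothness exponent `⊤`, `ContDiff` means analytic, so the identity theorem applies.
  have hA : AnalyticOnNhd ℝ P Set.univ := fun x _ =>
    (contDiff_of_mem_polySpace hP (m := ⊤)).analyticOnNhd x (Set.mem_univ x)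
  refine hA.eqOn_of_preconnected_of_eventuallyEq analyticOnNhd_const isPreconnected_univ
    (Set.mem_univ (0 : Pt d)) ?_ (Set.mem_univ x)
  filter_upwards [Metric.ball_mem_nhds (0 : Pt d) hρ] with y hy using h y hy

/-! ### Polynomial inequalities on balls centred at the origin. -/

/-- Restriction of polynomials to the closed unit ball. -/
def polyToBall (d r : ℕ) : polySpace d r →ₗ[ℝ] C(Metric.closedBall (0 : Pt d) 1, ℝ) where
  toFun P := ⟨fun x => P.1 x,
    (contDiff_of_mem_polySpace P.2 (m := 0)).continuous.comp continuous_subtype_val⟩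
  map_add' _ _ := rfl
  map_smul' _ _ := rfl

lemma memLp_closedBall {F : Type*} [NormedAddCommGroup F] [SecondCountableTopology F]
    {f : Pt d → F} (hf : Continuous f) (ρ : ℝ) :
    MemLp f 2 (volume.restrict (Metric.closedBall 0 ρ)) := by
  obtain ⟨C, hC⟩ := (isCompact_closedBall (0 : Pt d) ρ).exists_bound_of_continuousOn
    hf.continuousOn
  have : IsFiniteMeasure (volume.restrict (Metric.closedBall (0 : Pt d) ρ)) :=
    ⟨by simpa using measure_closedBall_lt_top⟩
  exact MemLp.of_bound hf.aestronglyMeasurable C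
    ((ae_restrict_iff' Metric.isClosed_closedBall.measurableSet).2 (Filter.Eventually.of_forall hC))

/-- A polynomial with zero L² norm on the small ball vanishes there, hence everywhere; so the L²
norm on the small ball controls the sup norm on the unit ball. -/
lemma exists_sup_le_ball (d r : ℕ) {ρ : ℝ} (hρ : 0 < ρ) : ∃ C ≥ 0, ∀ P ∈ polySpace d r,
    ∀ y ∈ Metric.closedBall (0 : Pt d) 1,
      P y ^ 2 ≤ C * ∫ x in Metric.closedBall (0 : Pt d) ρ, P x ^ 2 := by
  obtain ⟨C, hC, h⟩ := exists_sq_le_integral (μ := volume.restrict (Metric.closedBall (0 : Pt d) ρ))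
    (polyToBall d r) (polySpace d r).subtype
    (fun P => memLp_closedBall (contDiff_of_mem_polySpace P.2 (m := 0)).continuous ρ) (by
      intro P hP
      have hc := (contDiff_of_mem_polySpace P.2 (m := 0)).continuous
      have := eq_zero_of_setIntegral_ball_eq_zero (hc.norm.pow 2) (fun x => sq_nonneg _) hP
      have h0 := eq_const_of_eqOn_ball P.2 hρ (c := 0) fun x hx => by simpa using this x hx
      ext x
      exact h0 x)
  refine ⟨C, hC, fun P hP y hy => ?_⟩
  have := h ⟨P, hP⟩
  simp only [Submodule.coe_subtype, Real.norm_eq_abs, sq_abs] at this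
  refine le_trans ?_ this
  rw [← sq_abs]
  refine pow_le_pow_left₀ (abs_nonneg _) ?_ 2
  exact (polyToBall d r ⟨P, hP⟩).norm_coe_le_norm ⟨y, hy⟩

/-- The gradient as a linear map on polynomials. -/
def polyGradient (d r : ℕ) : polySpace d r →ₗ[ℝ] (Pt d → Pt d) where
  toFun P := gradient P.1
  map_add' P Q := funext fun x => gradient_add_apply
    ((contDiff_of_mem_polySpace P.2 (m := 1)).differentiable one_ne_zero x)
    ((contDiff_of_mem_polySpace Q.2 (m := 1)).differentiable one_ne_zero x)
  map_smul' c P := funext fun x => gradient_smul_apply c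
    ((contDiff_of_mem_polySpace P.2 (m := 1)).differentiable one_ne_zero x)

/-- Subtracting the value at the origin, on the closed unit ball. -/
def polyOsc (d r : ℕ) : polySpace d r →ₗ[ℝ] C(Metric.closedBall (0 : Pt d) 1, ℝ) where
  toFun P := ⟨fun x => P.1 x - P.1 0,
    ((contDiff_of_mem_polySpace P.2 (m := 0)).continuous.comp continuous_subtype_val).sub
      continuous_const⟩
  map_add' P Q := by ext x; simp; ring
  map_smul' c P := by ext x; simp; ring

/-- Zero gradient on the small ball makes the polynomial constant there, hence everywhere, so the
oscillation vanishes. -/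
lemma exists_osc_le_ball (d r : ℕ) {ρ : ℝ} (hρ : 0 < ρ) : ∃ C ≥ 0, ∀ P ∈ polySpace d r,
    ∀ y ∈ Metric.closedBall (0 : Pt d) 1,
      (P y - P 0) ^ 2 ≤ C * ∫ x in Metric.closedBall (0 : Pt d) ρ, ‖gradient P x‖ ^ 2 := by
  obtain ⟨C, hC, h⟩ := exists_sq_le_integral (μ := volume.restrict (Metric.closedBall (0 : Pt d) ρ))
    (polyOsc d r) (polyGradient d r)
    (fun P => memLp_closedBall (continuous_gradient (contDiff_of_mem_polySpace P.2)) ρ) (by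
      intro P hP
      have hc := continuous_gradient (contDiff_of_mem_polySpace P.2 (m := 1))
      have := eq_zero_of_setIntegral_ball_eq_zero (hc.norm.pow 2) (fun x => sq_nonneg _) hP
      have hconst : ∀ x ∈ Metric.ball (0 : Pt d) ρ, P.1 x = P.1 0 := fun x hx =>
        Metric.isOpen_ball.is_const_of_fderiv_eq_zero (𝕜 := ℝ)
          (convex_ball (0 : Pt d) ρ).isPreconnected
          ((contDiff_of_mem_polySpace P.2 (m := 1)).differentiable one_ne_zero).differentiableOn
          (fun y hy => by simpa [gradient] using this y hy) hx (Metric.mem_ball_self hρ)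
      have h0 := eq_const_of_eqOn_ball P.2 hρ hconst
      ext x
      exact sub_eq_zero.2 (h0 x))
  refine ⟨C, hC, fun P hP y hy => ?_⟩
  refine le_trans ?_ (h ⟨P, hP⟩)
  rw [← sq_abs]
  refine pow_le_pow_left₀ (abs_nonneg _) ?_ 2
  exact (polyOsc d r ⟨P, hP⟩).norm_coe_le_norm ⟨y, hy⟩

/-! ### Scaling to sets of size `h`. -/

lemma setIntegral_comp_add_smul (f : Pt d → ℝ) (c : Pt d) {h ρ : ℝ} (hh : 0 < h) (hρ : 0 ≤ ρ) :
    ∫ y in Metric.closedBall (0 : Pt d) ρ, f (c + h • y) =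
      (h ^ d)⁻¹ * ∫ x in Metric.closedBall c (h * ρ), f x := by
  have h1 := Measure.setIntegral_comp_smul_of_pos (μ := (volume : Measure (Pt d)))
    (fun x => f (c + x)) (Metric.closedBall (0 : Pt d) ρ) hh
  rw [h1, finrank_euclideanSpace_fin, smul_closedBall _ _ hρ, smul_zero, Real.norm_of_nonneg hh.le,
    smul_eq_mul]
  congr 1
  have h2 := (measurePreserving_add_left (volume : Measure (Pt d)) c).setIntegral_preimage_emb
    (measurableEmbedding_addLeft c) f (Metric.closedBall c (h * ρ))
  rw [← h2]
  congr 2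
  ext x; simp

lemma gradient_comp_add_smul {P : Pt d → ℝ} (hP : Differentiable ℝ P) (c : Pt d) (h : ℝ)
    (y : Pt d) : gradient (fun z => P (c + h • z)) y = h • gradient P (c + h • y) := by
  have h1 : HasFDerivAt (fun z : Pt d => c + h • z) (h • ContinuousLinearMap.id ℝ (Pt d)) y :=
    ((hasFDerivAt_id y).const_smul h).const_add c
  have h2 := (hP (c + h • y)).hasFDerivAt.comp y h1
  have h3 : fderiv ℝ (fun z => P (c + h • z)) y = h • fderiv ℝ P (c + h • y) := by
    rw [show (fun z => P (c + h • z)) = P ∘ fun z => c + h • z from rfl, h2.fderiv]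
    ext z; simp
  simp [gradient, h3]

lemma integrableOn_of_continuous {f : Pt d → ℝ} (hf : Continuous f) {K : Set (Pt d)}
    (hK : IsCompact K) : IntegrableOn f K :=
  hf.continuousOn.integrableOn_compact hK

/-- On a set of diameter at most `h` which contains a ball of comparable diameter, a polynomial is
bounded by its `L²` norm. -/
lemma exists_sup_le (d r : ℕ) {σ : ℝ} (hσ : 0 < σ) : ∃ C ≥ 0, ∀ P ∈ polySpace d r,
    ∀ (h : ℝ) (c : Pt d) (K : Set (Pt d)), 0 < h → IsCompact K →
      Metric.closedBall c (σ * h / 2) ⊆ K → K ⊆ Metric.closedBall c h →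
      ∀ y ∈ K, P y ^ 2 ≤ C * (h ^ d)⁻¹ * ∫ x in K, P x ^ 2 := by
  -- The map y ↦ c + h y takes the ball of radius `σ / 2` to the ball of radius `σ * h / 2` inside
  -- `K`, and the unit ball to a ball containing `K`.
  obtain ⟨C, hC, H⟩ := exists_sup_le_ball d r (half_pos hσ)
  refine ⟨C, hC, fun P hP h c K hh hK hBK hKB y hy => ?_⟩
  have hPc := (contDiff_of_mem_polySpace hP (m := 0)).continuous
  have hz : h⁻¹ • (y - c) ∈ Metric.closedBall (0 : Pt d) 1 := by
    have := hKB hy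
    rw [Metric.mem_closedBall, dist_eq_norm] at this
    rw [mem_closedBall_zero_iff, norm_smul, norm_inv, Real.norm_of_nonneg hh.le,
      inv_mul_le_iff₀ hh, mul_one]
    exact this
  have h1 := H _ (comp_mem_polySpace hP c h) _ hz
  rw [setIntegral_comp_add_smul (fun x => P x ^ 2) c hh (by positivity),
    smul_inv_smul₀ hh.ne', add_sub_cancel] at h1
  refine h1.trans ?_
  rw [← mul_assoc]
  refine mul_le_mul_of_nonneg_left ?_ (by positivity)
  refine setIntegral_mono_set (integrableOn_of_continuous (hPc.pow 2) hK)
    (Filter.Eventually.of_forall fun x => by positivity) (Filter.Eventually.of_forall ?_)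
  intro x hx
  refine hBK ?_
  rwa [show σ * h / 2 = h * (σ / 2) by ring]

/-- On a set of diameter at most `h` which contains a ball of comparable diameter, the oscillation
of a polynomial is bounded by the `L²` norm of its gradient. -/
lemma exists_osc_le (d r : ℕ) {σ : ℝ} (hσ : 0 < σ) : ∃ C ≥ 0, ∀ P ∈ polySpace d r,
    ∀ (h : ℝ) (c : Pt d) (K : Set (Pt d)), 0 < h → IsCompact K →
      Metric.closedBall c (σ * h / 2) ⊆ K → K ⊆ Metric.closedBall c h →
      ∀ y ∈ K, ∀ z ∈ K, (P y - P z) ^ 2 ≤ C * (h ^ 2 * (h ^ d)⁻¹) * ∫ x in K, ‖gradient P x‖ ^ 2 := by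
  obtain ⟨C, hC, H⟩ := exists_osc_le_ball d r (half_pos hσ)
  -- The values at `y` and `z` are compared through the centre `c`; the factor 4 is from (a - b)² ≤
  -- 2a² + 2b².
  refine ⟨4 * C, by positivity, fun P hP h c K hh hK hBK hKB y hy z hz => ?_⟩
  have hPc := contDiff_of_mem_polySpace hP (m := 1)
  have key : ∀ y ∈ K, (P y - P c) ^ 2 ≤ C * (h ^ 2 * (h ^ d)⁻¹) * ∫ x in K, ‖gradient P x‖ ^ 2 := by
    intro y hy
    have hz : h⁻¹ • (y - c) ∈ Metric.closedBall (0 : Pt d) 1 := by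
      have := hKB hy
      rw [Metric.mem_closedBall, dist_eq_norm] at this
      rw [mem_closedBall_zero_iff, norm_smul, norm_inv, Real.norm_of_nonneg hh.le,
        inv_mul_le_iff₀ hh, mul_one]
      exact this
    have h1 := H _ (comp_mem_polySpace hP c h) _ hz
    simp only [gradient_comp_add_smul (hPc.differentiable one_ne_zero)] at h1
    rw [setIntegral_comp_add_smul (fun x => ‖h • gradient P x‖ ^ 2) c hh (by positivity),
      smul_inv_smul₀ hh.ne', add_sub_cancel, smul_zero, add_zero] at h1
    simp only [norm_smul, mul_pow, Real.norm_of_nonneg hh.le] at h1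
    rw [integral_const_mul] at h1
    refine h1.trans ?_
    rw [show C * ((h ^ d)⁻¹ * (h ^ 2 * ∫ x in Metric.closedBall c (h * (σ / 2)), ‖gradient P x‖ ^ 2))
      = C * (h ^ 2 * (h ^ d)⁻¹) * ∫ x in Metric.closedBall c (h * (σ / 2)), ‖gradient P x‖ ^ 2 by ring]
    refine mul_le_mul_of_nonneg_left ?_ (by positivity)
    refine setIntegral_mono_set (integrableOn_of_continuous ((continuous_gradient hPc).norm.pow 2) hK)
      (Filter.Eventually.of_forall fun x => by positivity) (Filter.Eventually.of_forall ?_)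
    intro x hx
    refine hBK ?_
    rwa [show σ * h / 2 = h * (σ / 2) by ring]
  nlinarith [key y hy, key z hz, sq_nonneg ((P y - P c) + (P z - P c))]

end Polynomials

section Geometry

namespace Mesh

variable {d : ℕ} (M : Mesh d)

/-! ### Elements and barycentric coordinates -/

lemma mem_elements {T : Finset (Pt d)} : T ∈ M.elements ↔ T ∈ M.cplx.faces ∧ T.card = d + 1 := by
  simp [elements]

/-- The vertices of an element as an affine basis of the space. -/
def elementBasis {T : Finset (Pt d)} (hT : T ∈ M.elements) : AffineBasis T ℝ (Pt d) :=
  ⟨(↑), M.cplx.indep (M.mem_elements.1 hT).1, by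
    rw [(M.cplx.indep (M.mem_elements.1 hT).1).affineSpan_eq_top_iff_card_eq_finrank_add_one]
    simp [(M.mem_elements.1 hT).2]⟩

@[simp] lemma elementBasis_apply {T : Finset (Pt d)} (hT : T ∈ M.elements) (x : T) :
    M.elementBasis hT x = x := rfl

lemma range_elementBasis {T : Finset (Pt d)} (hT : T ∈ M.elements) :
    Set.range (M.elementBasis hT) = (T : Set (Pt d)) := by
  ext x; simp

lemma cell_eq {T : Finset (Pt d)} (hT : T ∈ M.elements) :
    cell T = {y | ∀ i, 0 ≤ (M.elementBasis hT).coord i y} := by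
  rw [← (M.elementBasis hT).convexHull_eq_nonneg_coord, range_elementBasis]; rfl

open Classical in
/-- The barycentric coordinate of an element at the point `x`, as an affine function on `ℝ^d`
(zero if `x` is not a vertex of the element). -/
def baryCoord {T : Finset (Pt d)} (hT : T ∈ M.elements) (x : Pt d) : Pt d →ᵃ[ℝ] ℝ :=
  if h : x ∈ T then (M.elementBasis hT).coord ⟨x, h⟩ else 0

lemma baryCoord_of_mem {T : Finset (Pt d)} (hT : T ∈ M.elements) {x : Pt d} (hx : x ∈ T) :
    M.baryCoord hT x = (M.elementBasis hT).coord ⟨x, hx⟩ := dif_pos hx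

lemma baryCoord_of_notMem {T : Finset (Pt d)} (hT : T ∈ M.elements) {x : Pt d} (hx : x ∉ T) :
    M.baryCoord hT x = 0 := dif_neg hx

lemma baryCoord_nonneg {T : Finset (Pt d)} (hT : T ∈ M.elements) (x : Pt d) {y : Pt d}
    (hy : y ∈ cell T) : 0 ≤ M.baryCoord hT x y := by
  by_cases hx : x ∈ T
  · rw [baryCoord_of_mem _ _ hx]
    rw [M.cell_eq hT] at hy
    exact hy _
  · simp [baryCoord_of_notMem _ _ hx]

lemma sum_baryCoord {T : Finset (Pt d)} (hT : T ∈ M.elements) (y : Pt d) :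
    ∑ x ∈ T, M.baryCoord hT x y = 1 := by
  rw [← (M.elementBasis hT).sum_coord_apply_eq_one y, Finset.univ_eq_attach, ← Finset.sum_attach]
  exact Finset.sum_congr rfl fun x _ => by rw [baryCoord_of_mem _ _ x.2]

lemma baryCoord_le_one {T : Finset (Pt d)} (hT : T ∈ M.elements) (x : Pt d) {y : Pt d}
    (hy : y ∈ cell T) : M.baryCoord hT x y ≤ 1 := by
  by_cases hx : x ∈ T
  · rw [← M.sum_baryCoord hT y]
    exact Finset.single_le_sum (f := fun x => M.baryCoord hT x y)
      (fun z _ => M.baryCoord_nonneg hT z hy) hx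
  · simp [baryCoord_of_notMem _ _ hx]

lemma isBary_baryCoord {T : Finset (Pt d)} (hT : T ∈ M.elements) {y : Pt d} (hy : y ∈ cell T) :
    M.IsBary y (Finsupp.onFinset T (fun x => M.baryCoord hT x y) fun x hx => by
      by_contra h; simp [baryCoord_of_notMem _ _ h] at hx) := by
  classical
  set w := Finsupp.onFinset T (fun x => M.baryCoord hT x y) fun x hx => by
      by_contra h; simp [baryCoord_of_notMem _ _ h] at hx
  have hsub : w.support ⊆ T := Finsupp.support_onFinset_subset
  have h1 : (w.sum fun _ c => c) = 1 := by
    rw [Finsupp.sum_of_support_subset _ hsub _ (by simp)]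
    exact M.sum_baryCoord hT y
  refine ⟨M.cplx.down_closed (M.mem_elements.1 hT).1 hsub ?_,
    fun x => M.baryCoord_nonneg hT x hy, h1, ?_⟩
  · by_contra h
    rw [Finset.not_nonempty_iff_eq_empty] at h
    rw [Finsupp.sum, h] at h1
    simp at h1
  · rw [Finsupp.sum_of_support_subset _ hsub _ (by simp)]
    conv_rhs => rw [← (M.elementBasis hT).linear_combination_coord_eq_self y]
    rw [Finset.univ_eq_attach, ← Finset.sum_attach]
    refine Finset.sum_congr rfl fun x _ => ?_
    rw [Finsupp.onFinset_apply, baryCoord_of_mem _ _ x.2, elementBasis_apply]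

lemma bary_eq_baryCoord {T : Finset (Pt d)} (hT : T ∈ M.elements) {y : Pt d} (hy : y ∈ cell T)
    (x : Pt d) : M.bary y x = M.baryCoord hT x y := by
  rw [M.bary_eq (M.isBary_baryCoord hT hy), Finsupp.onFinset_apply]

lemma baryCoord_self {T : Finset (Pt d)} (hT : T ∈ M.elements) {x : Pt d} (hx : x ∈ T) :
    M.baryCoord hT x x = 1 := by
  rw [baryCoord_of_mem _ _ hx]
  exact (M.elementBasis hT).coord_apply_eq ⟨x, hx⟩

lemma baryCoord_ne {T : Finset (Pt d)} (hT : T ∈ M.elements) {x z : Pt d} (hz : z ∈ T)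
    (h : x ≠ z) : M.baryCoord hT x z = 0 := by
  by_cases hx : x ∈ T
  · rw [baryCoord_of_mem _ _ hx]
    exact (M.elementBasis hT).coord_apply_ne (i := ⟨x, hx⟩) (j := ⟨z, hz⟩)
      (fun e => h (congrArg Subtype.val e))
  · simp [baryCoord_of_notMem _ _ hx]

/-! ### Geometry of cells -/

lemma convex_cell (T : Finset (Pt d)) : Convex ℝ (cell T) := convex_convexHull ℝ _

lemma isCompact_cell (T : Finset (Pt d)) : IsCompact (cell T) :=
  T.finite_toSet.isCompact_convexHull ℝ

lemma isClosed_cell (T : Finset (Pt d)) : IsClosed (cell T) := (isCompact_cell T).isClosed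

lemma subset_cell (T : Finset (Pt d)) : (T : Set (Pt d)) ⊆ cell T := subset_convexHull ℝ _

lemma interior_cell_nonempty {T : Finset (Pt d)} (hT : T ∈ M.elements) :
    (interior (cell T)).Nonempty := by
  unfold cell
  rw [interior_convexHull_nonempty_iff_affineSpan_eq_top, ← M.range_elementBasis hT]
  exact (M.elementBasis hT).tot

lemma closure_interior_cell {T : Finset (Pt d)} (hT : T ∈ M.elements) :
    closure (interior (cell T)) = cell T := by
  rw [(convex_cell T).closure_interior_eq_closure_of_nonempty_interior (M.interior_cell_nonempty hT),
    (isClosed_cell T).closure_eq]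

/-- By conformity the intersection lies in the affine span of the common vertices, of which there
are at most `d`, so this span is a proper affine subspace. -/
lemma volume_cell_inter {T T' : Finset (Pt d)} (hT : T ∈ M.elements) (hT' : T' ∈ M.elements)
    (h : T ≠ T') : volume (cell T ∩ cell T') = 0 := by
  classical
  obtain ⟨f, c⟩ := M.mem_elements.1 hT
  obtain ⟨f', c'⟩ := M.mem_elements.1 hT'
  have hsub := M.cplx.inter_subset_convexHull f f'
  have hne : (T ∩ T').card ≠ d + 1 := fun e => h <| by
    have h1 := Finset.eq_of_subset_of_card_le (Finset.inter_subset_left (s₁ := T) (s₂ := T')) (by omega)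
    have h2 := Finset.eq_of_subset_of_card_le (Finset.inter_subset_right (s₁ := T) (s₂ := T')) (by omega)
    rw [← h1, h2]
  refine measure_mono_null (hsub.trans (convexHull_subset_affineSpan _)) ?_
  refine Measure.addHaar_affineSubspace _ _ fun htop => hne ?_
  rw [← Finset.coe_inter] at htop
  have ind : AffineIndependent ℝ ((↑) : (T ∩ T' : Finset (Pt d)) → Pt d) :=
    (M.cplx.indep f).mono (by simp)
  have := ind.affineSpan_eq_top_iff_card_eq_finrank_add_one.1 (by rw [← htop]; congr 1; ext x; simp)
  simpa using this

lemma aedisjoint_cell {T T' : Finset (Pt d)} (hT : T ∈ M.elements) (hT' : T' ∈ M.elements)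
    (h : T ≠ T') : AEDisjoint volume (cell T) (cell T') := M.volume_cell_inter hT hT' h

/-! ### Subdomains and integration over them. -/

variable {M}

lemma isClosed_biUnion_cell (S : Finset (Finset (Pt d))) : IsClosed (⋃ T ∈ S, cell T) :=
  S.finite_toSet.isClosed_biUnion fun T _ => isClosed_cell T

/-- Every cell is the closure of its interior, so passing to the interior of the union loses no
cell. -/
lemma closure_subdomain {S : Finset (Finset (Pt d))} (hS : S ⊆ M.elements) :
    closure (subdomain S) = ⋃ T ∈ S, cell T := by
  refine Set.Subset.antisymm (closure_minimal interior_subset (isClosed_biUnion_cell S)) ?_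
  refine Set.iUnion₂_subset fun T hT => ?_
  rw [← M.closure_interior_cell (hS hT)]
  exact closure_mono (interior_mono (Set.subset_biUnion_of_mem (u := cell) hT))

lemma cell_subset_closure_subdomain {S : Finset (Finset (Pt d))} (hS : S ⊆ M.elements)
    {T : Finset (Pt d)} (hT : T ∈ S) : cell T ⊆ closure (subdomain S) := by
  rw [closure_subdomain hS]; exact Set.subset_biUnion_of_mem (u := cell) hT

lemma interior_cell_subset_subdomain {S : Finset (Finset (Pt d))}
    {T : Finset (Pt d)} (hT : T ∈ S) : interior (cell T) ⊆ subdomain S :=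
  interior_mono (Set.subset_biUnion_of_mem (u := cell) hT)

lemma subdomain_subset_domain {S : Finset (Finset (Pt d))} (hS : S ⊆ M.elements) :
    subdomain S ⊆ M.domain := by
  refine interior_mono (Set.iUnion₂_subset fun T hT => ?_)
  exact M.cplx.convexHull_subset_space (M.mem_elements.1 (hS hT)).1

/-- The difference lies in the frontiers of the cells, which are null because cells are convex. -/
lemma subdomain_ae_eq (S : Finset (Finset (Pt d))) :
    subdomain S =ᵐ[volume] ⋃ T ∈ S, cell T := by
  refine interior_subset.eventuallyLE.antisymm ?_
  rw [ae_le_set]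
  refine measure_mono_null (t := ⋃ T ∈ S, frontier (cell T)) ?_ ?_
  · rintro x ⟨hx, hx'⟩
    obtain ⟨T, hT, hxT⟩ := Set.mem_iUnion₂.1 hx
    refine Set.mem_iUnion₂.2 ⟨T, hT, subset_closure hxT, fun h => hx' ?_⟩
    exact interior_cell_subset_subdomain hT h
  · exact (measure_biUnion_null_iff S.countable_toSet).2
      fun T _ => (convex_cell T).addHaar_frontier _

lemma restrict_subdomain {S : Finset (Finset (Pt d))} (hS : S ⊆ M.elements) :
    (volume : Measure (Pt d)).restrict (subdomain S) = ∑ T ∈ S, volume.restrict (cell T) := by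
  classical
  rw [Measure.restrict_congr_set (subdomain_ae_eq S)]
  induction S using Finset.induction_on with
  | empty => simp
  | insert T S hTS ih =>
    rw [Finset.sum_insert hTS, Finset.set_biUnion_insert,
      ← ih fun x hx => hS (Finset.mem_insert_of_mem hx)]
    refine Measure.restrict_union₀ ?_ (isClosed_biUnion_cell S).measurableSet.nullMeasurableSet
    unfold AEDisjoint
    rw [Set.inter_iUnion₂]
    refine (measure_biUnion_null_iff S.countable_toSet).2 fun T' hT' => ?_
    exact M.volume_cell_inter (hS (Finset.mem_insert_self _ _)) (hS (Finset.mem_insert_of_mem hT'))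
      fun e => hTS (e ▸ hT')

lemma restrict_cell (T : Finset (Pt d)) :
    (volume : Measure (Pt d)).restrict (cell T) = volume.restrict (interior (cell T)) := by
  refine Measure.restrict_congr_set ?_
  exact (interior_ae_eq_of_null_frontier ((convex_cell T).addHaar_frontier _)).symm

lemma ae_mem_interior_cell (T : Finset (Pt d)) :
    ∀ᵐ x ∂(volume : Measure (Pt d)).restrict (cell T), x ∈ interior (cell T) := by
  rw [restrict_cell]; exact ae_restrict_mem isOpen_interior.measurableSet

lemma ae_subdomain_iff {S : Finset (Finset (Pt d))} (hS : S ⊆ M.elements) {p : Pt d → Prop} :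
    (∀ᵐ x ∂(volume : Measure (Pt d)).restrict (subdomain S), p x) ↔
      ∀ T ∈ S, ∀ᵐ x ∂(volume : Measure (Pt d)).restrict (cell T), p x := by
  rw [restrict_subdomain hS, ← Measure.sum_coe_finset, Measure.ae_sum_iff]
  simp

lemma integrable_subdomain_iff {S : Finset (Finset (Pt d))} (hS : S ⊆ M.elements) {f : Pt d → ℝ} :
    IntegrableOn f (subdomain S) ↔ ∀ T ∈ S, IntegrableOn f (cell T) := by
  rw [IntegrableOn, restrict_subdomain hS, integrable_finsetSum_measure]; rfl

lemma integral_subdomain {S : Finset (Finset (Pt d))} (hS : S ⊆ M.elements) {f : Pt d → ℝ}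
    (hf : ∀ T ∈ S, IntegrableOn f (cell T)) :
    ∫ x in subdomain S, f x = ∑ T ∈ S, ∫ x in cell T, f x := by
  rw [restrict_subdomain hS, integral_finsetSum_measure hf]

/-! ### Piecewise polynomial functions -/

/-- A vertex of the node outside `T` contributes the factor with `j = 0`, which is a multiple of a
barycentric coordinate that vanishes on `T`. -/
lemma basisFun_eq_zero {r : ℕ} {T : Finset (Pt d)} (hT : T ∈ M.elements) {α : Pt d →₀ ℕ}
    (h : ¬ α.support ⊆ T) {y : Pt d} (hy : y ∈ cell T) : M.basisFun r α y = 0 := by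
  obtain ⟨x, hx, hxT⟩ := Finset.not_subset.1 h
  refine Finset.prod_eq_zero hx (Finset.prod_eq_zero (i := 0) ?_ ?_)
  · exact Finset.mem_range.2 (Nat.pos_of_ne_zero (Finsupp.mem_support_iff.1 hx))
  · rw [M.bary_eq_baryCoord hT hy, baryCoord_of_notMem _ _ hxT]; simp

lemma prod_mem_polySpace {ι : Type*} (s : Finset ι) (m : ι → ℕ) (g : ι → Pt d → ℝ)
    (hg : ∀ i ∈ s, g i ∈ polySpace d (m i)) : ∏ i ∈ s, g i ∈ polySpace d (∑ i ∈ s, m i) := by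
  classical
  induction s using Finset.induction_on with
  | empty => simp [polySpace]
  | insert i s hi ih =>
    rw [Finset.prod_insert hi, Finset.sum_insert hi, polySpace, pow_add]
    exact Submodule.mul_mem_mul (hg i (Finset.mem_insert_self _ _))
      (ih fun j hj => hg j (Finset.mem_insert_of_mem hj))

lemma sum_of_mem_nodes {r : ℕ} {α : Pt d →₀ ℕ} (hα : α ∈ M.nodes r) :
    ∑ x ∈ α.support, α x = r := by
  classical exact (Finset.mem_finsuppAntidiag'.1 (Finset.mem_filter.1 hα).1).1

lemma exists_poly_basisFun {r : ℕ} {T : Finset (Pt d)} (hT : T ∈ M.elements) {α : Pt d →₀ ℕ}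
    (hα : α ∈ M.nodes r) : ∃ P ∈ polySpace d r, Set.EqOn (M.basisFun r α) P (cell T) := by
  refine ⟨∏ x ∈ α.support, ∏ j ∈ Finset.range (α x),
    fun y => ((r : ℝ) * M.baryCoord hT x y - (j : ℝ)) / ((j : ℝ) + 1), ?_, fun y hy => ?_⟩
  · have := prod_mem_polySpace α.support α (fun x => ∏ j ∈ Finset.range (α x),
      fun y => ((r : ℝ) * M.baryCoord hT x y - (j : ℝ)) / ((j : ℝ) + 1)) fun x _ => by
        have := prod_mem_polySpace (Finset.range (α x)) (fun _ => 1)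
          (fun j y => ((r : ℝ) * M.baryCoord hT x y - (j : ℝ)) / ((j : ℝ) + 1)) fun j _ => by
            rw [polySpace, pow_one]
            have h1 := sub_mem (Submodule.smul_mem _ (r : ℝ)
              (affineMap_mem_affineFun (M.baryCoord hT x))) (const_mem_affineFun (d := d) (j : ℝ))
            convert! Submodule.smul_mem _ ((j : ℝ) + 1)⁻¹ h1 using 1
            ext y; simp [div_eq_inv_mul]
        simpa using this
    rwa [sum_of_mem_nodes hα] at this
  · simp only [Finset.prod_apply, basisFun]
    exact Finset.prod_congr rfl fun x _ => Finset.prod_congr rfl fun j _ => by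
      rw [M.bary_eq_baryCoord hT hy]

/-- Functions which are polynomial of degree at most `r` on every cell of `S`. -/
def pwPoly (r : ℕ) (S : Finset (Finset (Pt d))) : Submodule ℝ (Pt d → ℝ) where
  carrier := {v | ∀ T ∈ S, ∃ P ∈ polySpace d r, Set.EqOn v P (cell T)}
  zero_mem' := fun _ _ => ⟨0, zero_mem _, fun _ _ => rfl⟩
  add_mem' := fun {u v} hu hv T hT => by
    obtain ⟨P, hP, e⟩ := hu T hT
    obtain ⟨Q, hQ, e'⟩ := hv T hT
    exact ⟨P + Q, add_mem hP hQ, fun y hy => by simp [e hy, e' hy]⟩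
  smul_mem' := fun c {u} hu T hT => by
    obtain ⟨P, hP, e⟩ := hu T hT
    exact ⟨c • P, Submodule.smul_mem _ c hP, fun y hy => by simp [e hy]⟩

lemma mem_nodes_of_mem_dofs {r : ℕ} {α : Pt d →₀ ℕ} (h : α ∈ M.dofs r) : α ∈ M.nodes r := by
  classical exact (Finset.mem_filter.1 h).1

lemma mem_dofs_of_mem_innerDofs {r : ℕ} {Ω' : Set (Pt d)} {α : Pt d →₀ ℕ}
    (h : α ∈ M.innerDofs r Ω') : α ∈ M.dofs r := by
  classical exact (Finset.mem_filter.1 h).1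

lemma basisFun_mem_femSpace {r : ℕ} {α : Pt d →₀ ℕ} (h : α ∈ M.dofs r) :
    M.basisFun r α ∈ M.femSpace r := Submodule.subset_span ⟨α, h, rfl⟩

lemma femSpace_le_pwPoly {r : ℕ} {S : Finset (Finset (Pt d))} (hS : S ⊆ M.elements) :
    M.femSpace r ≤ pwPoly r S := by
  refine Submodule.span_le.2 ?_
  rintro f ⟨α, hα, rfl⟩ T hT
  exact exists_poly_basisFun (hS hT) (mem_nodes_of_mem_dofs hα)

lemma restrict_eqOn_cell {S : Finset (Finset (Pt d))} (hS : S ⊆ M.elements)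
    {T : Finset (Pt d)} (hT : T ∈ S) (f : Pt d → ℝ) :
    Set.EqOn (restrict (subdomain S) f) f (cell T) := fun _ hy =>
  Set.indicator_of_mem (cell_subset_closure_subdomain hS hT hy) f

lemma restrictedSpace_le_pwPoly {r : ℕ} {S : Finset (Finset (Pt d))} (hS : S ⊆ M.elements) :
    M.restrictedSpace r (subdomain S) ≤ pwPoly r S := by
  rintro _ ⟨f, hf, rfl⟩ T hT
  obtain ⟨P, hP, e⟩ := femSpace_le_pwPoly hS hf T hT
  exact ⟨P, hP, (restrict_eqOn_cell hS hT f).trans e⟩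

lemma femSpace_eq_sum {r : ℕ} (hr : 1 ≤ r) {f : Pt d → ℝ} (hf : f ∈ M.femSpace r) :
    f = ∑ α ∈ M.dofs r, f (nodePos r α) • M.basisFun r α := by
  induction hf using Submodule.span_induction with
  | mem f hf =>
    obtain ⟨β, hβ, rfl⟩ := hf
    rw [Finset.sum_eq_single β]
    · rw [M.basisFun_node hr (mem_nodes_of_mem_dofs hβ) (mem_nodes_of_mem_dofs hβ), if_pos rfl,
        one_smul]
    · intro α hα h
      rw [M.basisFun_node hr (mem_nodes_of_mem_dofs hβ) (mem_nodes_of_mem_dofs hα), if_neg h.symm,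
        zero_smul]
    · exact fun h => absurd hβ h
  | zero => simp
  | add f g _ _ hf hg =>
    conv_lhs => rw [hf, hg]
    simp [add_smul, Finset.sum_add_distrib]
  | smul c f _ hf =>
    conv_lhs => rw [hf]
    simp [Finset.smul_sum, smul_smul]

/-- This supplies the zeros at nodes on ∂Ω, which end chains in the layer condition. -/
lemma femSpace_node_eq_zero {r : ℕ} (hr : 1 ≤ r) {f : Pt d → ℝ} (hf : f ∈ M.femSpace r)
    {α : Pt d →₀ ℕ} (hα : α ∈ M.nodes r) (h : α ∉ M.dofs r) : f (nodePos r α) = 0 := by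
  rw [femSpace_eq_sum hr hf]
  simp only [Finset.sum_apply, Pi.smul_apply, smul_eq_mul]
  refine Finset.sum_eq_zero fun β hβ => ?_
  rw [M.basisFun_node hr (mem_nodes_of_mem_dofs hβ) hα, if_neg (fun e : β = α => h (e ▸ hβ)),
    mul_zero]

lemma nodePos_mem_cell {r : ℕ} (hr : 1 ≤ r) {T : Finset (Pt d)} {α : Pt d →₀ ℕ}
    (hα : α ∈ M.nodes r) (h : α.support ⊆ T) : nodePos r α ∈ cell T := by
  have hr0 : (r : ℝ) ≠ 0 := by positivity
  refine convexHull_mono (Finset.coe_subset.2 h) ?_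
  refine (convex_convexHull ℝ _).sum_mem (fun x _ => by positivity) ?_
    fun x hx => subset_convexHull ℝ _ (Finset.mem_coe.2 hx)
  rw [← Finset.sum_div, div_eq_one_iff_eq hr0, ← sum_of_mem_nodes hα]
  push_cast
  rfl

lemma exists_element_of_mem_nodes {r : ℕ} {α : Pt d →₀ ℕ} (hα : α ∈ M.nodes r) :
    ∃ T ∈ M.elements, α.support ⊆ T := by
  classical
  obtain ⟨T, hT, hs, hc⟩ := M.pure_faces _ (Finset.mem_filter.1 hα).2
  exact ⟨T, M.mem_elements.2 ⟨hT, hc⟩, hs⟩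

end Mesh

end Geometry

section ElementEstimates

namespace Mesh

variable {d : ℕ} {M : Mesh d}

/-! ### Estimates on one element -/

lemma gradient_eq_of_eqOn {f P : Pt d → ℝ} {T : Finset (Pt d)} (h : Set.EqOn f P (cell T))
    {x : Pt d} (hx : x ∈ interior (cell T)) : gradient f x = gradient P x := by
  have : f =ᶠ[nhds x] P := by
    filter_upwards [mem_interior_iff_mem_nhds.1 hx] with y hy using h hy
  simp [gradient, this.fderiv_eq]

lemma gradient_ae_eq {f P : Pt d → ℝ} {T : Finset (Pt d)} (h : Set.EqOn f P (cell T)) :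
    gradient f =ᵐ[volume.restrict (cell T)] gradient P := by
  filter_upwards [ae_mem_interior_cell T] with x hx using gradient_eq_of_eqOn h hx

lemma gradSq_congr {f P : Pt d → ℝ} {T : Finset (Pt d)} (h : Set.EqOn f P (cell T)) :
    gradSq (cell T) f = gradSq (cell T) P := by
  refine integral_congr_ae ?_
  filter_upwards [gradient_ae_eq h] with x hx
  rw [hx]

lemma l2Sq_congr {f P : Pt d → ℝ} {T : Finset (Pt d)} (h : Set.EqOn f P (cell T)) :
    l2Sq (cell T) f = l2Sq (cell T) P :=
  setIntegral_congr_fun (isClosed_cell T).measurableSet fun x hx => by simp [h hx]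

lemma gradSq_nonneg (Ω' : Set (Pt d)) (f : Pt d → ℝ) : 0 ≤ gradSq Ω' f :=
  integral_nonneg fun _ => sq_nonneg _

lemma l2Sq_nonneg (Ω' : Set (Pt d)) (f : Pt d → ℝ) : 0 ≤ l2Sq Ω' f :=
  integral_nonneg fun _ => sq_nonneg _

lemma integrableOn_cell_sq {r : ℕ} {S : Finset (Finset (Pt d))} {f : Pt d → ℝ}
    (hf : f ∈ pwPoly r S) {T : Finset (Pt d)} (hT : T ∈ S) :
    IntegrableOn (fun x => f x ^ 2) (cell T) := by
  obtain ⟨P, hP, e⟩ := hf T hT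
  refine (integrableOn_of_continuous ((contDiff_of_mem_polySpace hP (m := 0)).continuous.pow 2)
    (isCompact_cell T)).congr_fun (fun x hx => ?_) (isClosed_cell T).measurableSet
  simp [e hx]

lemma integrableOn_cell_gradSq {r : ℕ} {S : Finset (Finset (Pt d))} {f : Pt d → ℝ}
    (hf : f ∈ pwPoly r S) {T : Finset (Pt d)} (hT : T ∈ S) :
    IntegrableOn (fun x => ‖gradient f x‖ ^ 2) (cell T) := by
  obtain ⟨P, hP, e⟩ := hf T hT
  refine (integrableOn_of_continuous ((continuous_gradient
    (contDiff_of_mem_polySpace hP)).norm.pow 2) (isCompact_cell T)).congr ?_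
  filter_upwards [gradient_ae_eq e] with x hx
  simp [hx]

lemma l2Sq_subdomain {r : ℕ} {S : Finset (Finset (Pt d))} (hS : S ⊆ M.elements) {f : Pt d → ℝ}
    (hf : f ∈ pwPoly r S) : l2Sq (subdomain S) f = ∑ T ∈ S, l2Sq (cell T) f :=
  integral_subdomain hS fun _ hT => integrableOn_cell_sq hf hT

lemma gradSq_subdomain {r : ℕ} {S : Finset (Finset (Pt d))} (hS : S ⊆ M.elements) {f : Pt d → ℝ}
    (hf : f ∈ pwPoly r S) : gradSq (subdomain S) f = ∑ T ∈ S, gradSq (cell T) f :=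
  integral_subdomain hS fun _ hT => integrableOn_cell_gradSq hf hT

lemma isBounded_cell (T : Finset (Pt d)) : Bornology.IsBounded (cell T) :=
  (isCompact_cell T).isBounded

lemma diam_cell_pos (hd : 1 ≤ d) {T : Finset (Pt d)} (hT : T ∈ M.elements) :
    0 < Metric.diam (cell T) := by
  obtain ⟨x, hx, y, hy, hxy⟩ := Finset.one_lt_card.1
    (show 1 < T.card by rw [(M.mem_elements.1 hT).2]; omega)
  exact (dist_pos.2 hxy).trans_le
    (Metric.dist_le_diam_of_mem (isBounded_cell T) (subset_cell T hx) (subset_cell T hy))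

lemma diam_cell_le_meshSize {T : Finset (Pt d)} (hT : T ∈ M.elements) :
    Metric.diam (cell T) ≤ M.meshSize :=
  le_ciSup (f := fun T : {T // T ∈ M.elements} => Metric.diam (cell T.1))
    (Set.finite_range _).bddAbove ⟨T, hT⟩

lemma cell_subset_closedBall {T : Finset (Pt d)} {x : Pt d} (hx : x ∈ cell T) :
    cell T ⊆ Metric.closedBall x (Metric.diam (cell T)) := fun _ hy =>
  Metric.dist_le_diam_of_mem (isBounded_cell T) hy hx

lemma ShapeRegular.exists_ball {σ : ℝ} (hM : M.ShapeRegular σ) (hσ : 0 < σ)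
    {T : Finset (Pt d)} (hT : T ∈ M.elements) :
    ∃ c, Metric.closedBall c (σ * Metric.diam (cell T) / 2) ⊆ cell T ∧
      cell T ⊆ Metric.closedBall c (Metric.diam (cell T)) := by
  obtain ⟨c, hc⟩ := hM T hT
  have := Metric.diam_nonneg (s := cell T)
  exact ⟨c, hc, cell_subset_closedBall (hc (Metric.mem_closedBall_self (by positivity)))⟩

lemma exists_sup_le_l2Sq (d r : ℕ) (hd : 1 ≤ d) {σ : ℝ} (hσ : 0 < σ) :
    ∃ C ≥ 0, ∀ M : Mesh d, M.ShapeRegular σ → ∀ S ⊆ M.elements, ∀ f ∈ pwPoly r S, ∀ T ∈ S,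
      ∀ y ∈ cell T, f y ^ 2 ≤ C * (Metric.diam (cell T) ^ d)⁻¹ * l2Sq (cell T) f := by
  obtain ⟨C, hC, H⟩ := exists_sup_le d r hσ
  refine ⟨C, hC, fun M hM S hS f hf T hT y hy => ?_⟩
  obtain ⟨P, hP, e⟩ := hf T hT
  obtain ⟨c, h1, h2⟩ := hM.exists_ball hσ (hS hT)
  rw [l2Sq_congr e, e hy]
  exact H P hP _ c _ (diam_cell_pos hd (hS hT)) (isCompact_cell T) h1 h2 y hy

lemma exists_osc_le_gradSq (d r : ℕ) (hd : 1 ≤ d) {σ : ℝ} (hσ : 0 < σ) :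
    ∃ C ≥ 0, ∀ M : Mesh d, M.ShapeRegular σ → ∀ S ⊆ M.elements, ∀ f ∈ pwPoly r S, ∀ T ∈ S,
      ∀ y ∈ cell T, ∀ z ∈ cell T, (f y - f z) ^ 2 ≤
        C * (Metric.diam (cell T) ^ 2 * (Metric.diam (cell T) ^ d)⁻¹) * gradSq (cell T) f := by
  obtain ⟨C, hC, H⟩ := exists_osc_le d r hσ
  refine ⟨C, hC, fun M hM S hS f hf T hT y hy z hz => ?_⟩
  obtain ⟨P, hP, e⟩ := hf T hT
  obtain ⟨c, h1, h2⟩ := hM.exists_ball hσ (hS hT)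
  rw [gradSq_congr e, e hy, e hz]
  exact H P hP _ c _ (diam_cell_pos hd (hS hT)) (isCompact_cell T) h1 h2 y hy z hz

/-- The volume of the unit ball. -/
def ballVol (d : ℕ) : ℝ := (volume : Measure (Pt d)).real (Metric.ball 0 1)

lemma ballVol_pos (d : ℕ) : 0 < ballVol d :=
  ENNReal.toReal_pos (Metric.measure_ball_pos _ _ one_pos).ne' measure_ball_lt_top.ne

lemma volume_closedBall_eq (x : Pt d) {R : ℝ} (hR : 0 ≤ R) :
    (volume : Measure (Pt d)).real (Metric.closedBall x R) = R ^ d * ballVol d := by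
  rw [Measure.addHaar_real_closedBall _ _ hR, finrank_euclideanSpace_fin, ballVol]

lemma volume_cell_le {T : Finset (Pt d)} (hT : T ∈ M.elements) :
    (volume : Measure (Pt d)).real (cell T) ≤ Metric.diam (cell T) ^ d * ballVol d := by
  obtain ⟨x, hx⟩ := M.interior_cell_nonempty hT
  rw [← volume_closedBall_eq x Metric.diam_nonneg]
  exact measureReal_mono (cell_subset_closedBall (interior_subset hx))
    measure_closedBall_lt_top.ne

lemma l2Sq_cell_le {T : Finset (Pt d)} (hT : T ∈ M.elements) {f : Pt d → ℝ} {B : ℝ} (hB : 0 ≤ B)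
    (h : ∀ y ∈ cell T, f y ^ 2 ≤ B) :
    l2Sq (cell T) f ≤ ballVol d * Metric.diam (cell T) ^ d * B := by
  have h1 := norm_setIntegral_le_of_norm_le_const (μ := volume) (f := fun x => f x ^ 2)
    (isCompact_cell T).measure_lt_top (C := B) fun x hx => by
      rw [Real.norm_of_nonneg (sq_nonneg _)]; exact h x hx
  refine (le_abs_self _).trans (h1.trans ?_)
  rw [mul_comm]
  exact mul_le_mul_of_nonneg_right ((volume_cell_le hT).trans_eq (mul_comm _ _)) hB

/-! ### Chains of elements -/

/-- The barycentric coordinate of `x` increases by 1 from `y` to `x`, hence by 2ρ / dist x y along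
the diameter of the ball parallel to that edge. In the cell it stays between 0 and 1. -/
lemma two_mul_radius_le_dist {T : Finset (Pt d)} (hT : T ∈ M.elements) {c : Pt d} {ρ : ℝ}
    (hρ : 0 < ρ) (hc : Metric.closedBall c ρ ⊆ cell T) {x y : Pt d} (hx : x ∈ T) (hy : y ∈ T)
    (hxy : x ≠ y) : 2 * ρ ≤ dist x y := by
  have hpos : 0 < dist x y := dist_pos.2 hxy
  set e : Pt d := (ρ / dist x y) • (x - y)
  have he : ‖e‖ = ρ := by
    rw [norm_smul, ← dist_eq_norm, Real.norm_of_nonneg (by positivity)]; field_simp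
  set l := M.baryCoord hT x
  have h1 : l (c + e) ≤ 1 := M.baryCoord_le_one hT x (hc (by simp [he]))
  have h2 : 0 ≤ l (c - e) := M.baryCoord_nonneg hT x (hc (by simp [he]))
  have hl : l.linear (x - y) = 1 := by
    have := l.linearMap_vsub x y
    rw [vsub_eq_sub, vsub_eq_sub, M.baryCoord_self hT hx, M.baryCoord_ne hT hy hxy] at this
    simpa using this
  have h3 : l (c + e) - l (c - e) = 2 * (ρ / dist x y) := by
    have := l.linearMap_vsub (c + e) (c - e)
    rw [vsub_eq_sub, vsub_eq_sub, show c + e - (c - e) = (2 * (ρ / dist x y)) • (x - y) by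
      rw [mul_smul, two_smul]; simp [e], map_smul, hl] at this
    simpa using this.symm
  have h4 : 2 * (ρ / dist x y) ≤ 1 := by linarith
  rw [← mul_div_assoc, div_le_one hpos] at h4
  exact h4

open Classical in
-- For `d ≥ 2` a common facet contains an edge; its length is at least the diameter of the ball in
-- `T` and at most the diameter of `T'`.
lemma ShapeRegular.diam_le_of_card_inter {σ : ℝ} (hM : M.ShapeRegular σ) (hσ : 0 < σ) (hd : 2 ≤ d)
    {T T' : Finset (Pt d)} (hT : T ∈ M.elements) (h : (T ∩ T').card = d) :
    σ * Metric.diam (cell T) ≤ Metric.diam (cell T') := by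
  obtain ⟨x, hx, y, hy, hxy⟩ := Finset.one_lt_card.1 (show 1 < (T ∩ T').card by omega)
  rw [Finset.mem_inter] at hx hy
  obtain ⟨c, hc, -⟩ := hM.exists_ball hσ hT
  have := diam_cell_pos (by omega) hT
  have h1 := two_mul_radius_le_dist hT (by positivity) hc hx.1 hy.1 hxy
  have h2 := Metric.dist_le_diam_of_mem (isBounded_cell T') (subset_cell T' hx.2)
    (subset_cell T' hy.2)
  linarith

/-- Any two members of a chain are at most `j` steps apart, in either order, and `σ ≤ 1` allows the
uniform exponent `j`. -/
lemma pow_mul_le_of_forall_step {σ : ℝ} (h0 : 0 < σ) (h1 : σ ≤ 1) {j : ℕ} {u : ℕ → ℝ}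
    (hu : ∀ a, 0 ≤ u a) (h : ∀ a < j, σ * u a ≤ u (a + 1) ∧ σ * u (a + 1) ≤ u a) {a b : ℕ}
    (ha : a ≤ j) (hb : b ≤ j) : σ ^ j * u a ≤ u b := by
  have key : ∀ n a, a + n ≤ j → σ ^ n * u a ≤ u (a + n) ∧ σ ^ n * u (a + n) ≤ u a := by
    intro n
    induction n with
    | zero => simp
    | succ n ih =>
      intro a ha
      obtain ⟨e1, e2⟩ := ih a (by omega)
      obtain ⟨f1, f2⟩ := h (a + n) (by omega)
      constructor
      · calc σ ^ (n + 1) * u a = σ * (σ ^ n * u a) := by ring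
          _ ≤ σ * u (a + n) := by gcongr
          _ ≤ _ := f1
      · calc σ ^ (n + 1) * u (a + (n + 1)) = σ ^ n * (σ * u (a + n + 1)) := by rw [← add_assoc]; ring
          _ ≤ σ ^ n * u (a + n) := by gcongr
          _ ≤ _ := e2
  have hle : ∀ n ≤ j, ∀ x, 0 ≤ x → σ ^ j * x ≤ σ ^ n * x := fun n hn x hx =>
    mul_le_mul_of_nonneg_right (pow_le_pow_of_le_one h0.le h1 hn) hx
  rcases le_total a b with hab | hab
  · obtain ⟨n, rfl⟩ := Nat.exists_eq_add_of_le hab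
    exact (hle n (by omega) _ (hu a)).trans (key n a hb).1
  · obtain ⟨n, rfl⟩ := Nat.exists_eq_add_of_le hab
    exact (hle n (by omega) _ (hu _)).trans (key n b ha).2

open Classical in
-- Triangle inequality through common vertices of consecutive elements. With `ψ` the identity it
-- bounds the length of the chain, with `ψ` a spline it bounds the variation of its values.
lemma dist_le_sum_of_chain {X : Type*} [PseudoMetricSpace X] (ψ : Pt d → X) (hd : 1 ≤ d)
    {τ : ℕ → Finset (Pt d)} {D : ℕ → ℝ} {j : ℕ} (hadj : ∀ a < j, (τ a ∩ τ (a + 1)).card = d)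
    (hD : ∀ a ≤ j, ∀ y ∈ cell (τ a), ∀ z ∈ cell (τ a), dist (ψ y) (ψ z) ≤ D a)
    {x z : Pt d} (hx : x ∈ cell (τ 0)) (hz : z ∈ cell (τ j)) :
    dist (ψ x) (ψ z) ≤ ∑ a ∈ Finset.range (j + 1), D a := by
  induction j generalizing z with
  | zero => simpa using hD 0 le_rfl x hx z hz
  | succ j ih =>
    obtain ⟨v, hv⟩ := Finset.card_pos.1 (show 0 < (τ j ∩ τ (j + 1)).card by
      rw [hadj j (by omega)]; omega)
    rw [Finset.mem_inter] at hv
    have h1 := ih (fun a ha => hadj a (by omega)) (fun a ha => hD a (by omega))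
      (subset_cell _ hv.1)
    have h2 := hD (j + 1) le_rfl v (subset_cell _ hv.2) z hz
    rw [Finset.sum_range_succ]
    linarith [dist_triangle (ψ x) (ψ v) (ψ z)]

/-- Two elements of comparable size at a distance comparable to their size. -/
def Near (Q : ℝ) (T T' : Finset (Pt d)) : Prop :=
  Metric.diam (cell T') ≤ Q * Metric.diam (cell T) ∧
    ∀ x ∈ cell T, ∀ x' ∈ cell T', dist x x' ≤ Q * Metric.diam (cell T')

/-- Packing argument: the cells of `F` overlap in null sets, lie in a ball of radius Q h', and each
contains a ball of radius at least σ h' / (2Q). -/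
lemma ShapeRegular.card_near_le {σ : ℝ} (hM : M.ShapeRegular σ) (hσ : 0 < σ) (hd : 1 ≤ d)
    {Q : ℝ} (hQ : 0 < Q) {T' : Finset (Pt d)} (hT' : T' ∈ M.elements)
    {F : Finset (Finset (Pt d))} (hF : F ⊆ M.elements) (hN : ∀ T ∈ F, Near Q T T') :
    (F.card : ℝ) ≤ (2 * Q ^ 2 / σ) ^ d := by
  set h' := Metric.diam (cell T')
  have hh' : 0 < h' := diam_cell_pos hd hT'
  obtain ⟨x', hx'⟩ := M.interior_cell_nonempty hT'
  have h1 : (volume : Measure (Pt d)).real (⋃ T ∈ F, cell T) ≤ (Q * h') ^ d * ballVol d := by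
    rw [← volume_closedBall_eq x' (by positivity)]
    refine measureReal_mono (Set.iUnion₂_subset fun T hT x hx => ?_)
      measure_closedBall_lt_top.ne
    exact (hN T hT).2 x hx x' (interior_subset hx')
  have h2 : (volume : Measure (Pt d)).real (⋃ T ∈ F, cell T) =
      ∑ T ∈ F, (volume : Measure (Pt d)).real (cell T) := by
    refine measureReal_biUnion_finset₀ (fun T hT T' hT' hne => ?_)
      (fun T _ => (isClosed_cell T).measurableSet.nullMeasurableSet)
      (fun T _ => (isCompact_cell T).measure_lt_top.ne)
    exact M.aedisjoint_cell (hF hT) (hF hT') hne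
  have h3 : ∀ T ∈ F, (σ * h' / (2 * Q)) ^ d * ballVol d ≤
      (volume : Measure (Pt d)).real (cell T) := by
    intro T hT
    obtain ⟨c, hc, -⟩ := hM.exists_ball hσ (hF hT)
    refine le_trans ?_ (measureReal_mono hc (isCompact_cell T).measure_lt_top.ne)
    have := diam_cell_pos hd (hF hT)
    rw [volume_closedBall_eq c (by positivity)]
    refine mul_le_mul_of_nonneg_right (pow_le_pow_left₀ (by positivity) ?_ d) (ballVol_pos d).le
    rw [div_le_div_iff₀ (by positivity) two_pos]
    have := (hN T hT).1
    calc σ * h' * 2 ≤ σ * (Q * Metric.diam (cell T)) * 2 := by gcongr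
      _ = _ := by ring
  have h4 := Finset.sum_le_sum h3
  rw [Finset.sum_const, nsmul_eq_mul, ← h2] at h4
  have h5 := h4.trans h1
  rw [← mul_assoc] at h5
  have h6 := le_of_mul_le_mul_right h5 (ballVol_pos d)
  rw [← le_div_iff₀ (by positivity), ← div_pow] at h6
  convert! h6 using 2
  field_simp

open Classical in
/-- The bound of a polynomial spline on the first element of a chain at whose end it vanishes. -/
lemma exists_l2Sq_le_of_chain (d r : ℕ) (hd : 2 ≤ d) {σ : ℝ} (hσ : 0 < σ) (hσ1 : σ ≤ 1) (L : ℕ) :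
    ∃ Q > 0, ∃ C ≥ 0, ∀ M : Mesh d, M.ShapeRegular σ → ∀ S ⊆ M.elements, ∀ f ∈ pwPoly r S,
      ∀ j ≤ L, ∀ τ : ℕ → Finset (Pt d), (∀ a ≤ j, τ a ∈ S) →
        (∀ a < j, (τ a ∩ τ (a + 1)).card = d) → (∃ z ∈ cell (τ j), f z = 0) →
        l2Sq (cell (τ 0)) f ≤
          C * M.meshSize ^ 2 * ∑ T' ∈ S.filter (Near Q (τ 0)), gradSq (cell T') f := by
  obtain ⟨C, hC, H⟩ := exists_osc_le_gradSq d r (by omega) hσ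
  set δ := σ ^ L
  have hδ : 0 < δ := by positivity
  have hδ1 : δ ≤ 1 := pow_le_one₀ hσ.le hσ1
  -- `δ` bounds the ratio of any two diameters in a chain from below, and a chain has at most `L +
  -- 1` elements. In the constant, `ballVol d` comes from L² ≤ sup, one factor `L + 1` from
  -- Cauchy–Schwarz, one from the number of terms, and `(δ ^ d)⁻¹` from the ratio of volumes.
  refine ⟨(L + 1) / δ, by positivity, ballVol d * (L + 1) ^ 2 * C * (δ ^ d)⁻¹,
    by have := ballVol_pos d; positivity, ?_⟩
  intro M hM S hS f hf j hj τ hτ hadj ⟨z, hz, hfz⟩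
  set u : ℕ → ℝ := fun a => Metric.diam (cell (τ a))
  have hu0 : ∀ a, 0 ≤ u a := fun a => Metric.diam_nonneg
  have hupos : ∀ a ≤ j, 0 < u a := fun a ha => diam_cell_pos (by omega) (hS (hτ a ha))
  have hcomp : ∀ a b, a ≤ j → b ≤ j → δ * u a ≤ u b := fun a b ha hb => by
    have h1 := pow_mul_le_of_forall_step hσ hσ1 hu0 (fun a ha =>
      ⟨hM.diam_le_of_card_inter hσ hd (hS (hτ a ha.le)) (hadj a ha),
        hM.diam_le_of_card_inter hσ hd (hS (hτ (a + 1) ha))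
          (by rw [Finset.inter_comm]; exact hadj a ha)⟩) ha hb
    exact (mul_le_mul_of_nonneg_right (pow_le_pow_of_le_one hσ.le hσ1 hj) (hu0 a)).trans h1
  have hjL : (j : ℝ) ≤ L := by exact_mod_cast hj
  -- all elements of the chain are near the first one
  have hnear : ∀ b ≤ j, Near ((L + 1) / δ) (τ 0) (τ b) := by
    intro b hb
    refine ⟨?_, fun x hx x' hx' => ?_⟩
    · have := hcomp b 0 hb (Nat.zero_le _)
      rw [div_mul_eq_mul_div, le_div_iff₀ hδ]
      have h0 := hu0 0
      have hL : (0 : ℝ) ≤ L := Nat.cast_nonneg L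
      change u b * δ ≤ (L + 1) * u 0
      nlinarith
    · have h1 := dist_le_sum_of_chain (id : Pt d → Pt d) (by omega) (D := u) (τ := τ) (j := b)
        (fun a ha => hadj a (by omega))
        (fun a _ y hy z hz => Metric.dist_le_diam_of_mem (isBounded_cell _) hy hz) hx hx'
      refine h1.trans ?_
      have h2 : ∀ a ∈ Finset.range (b + 1), u a ≤ u b / δ := fun a ha => by
        rw [le_div_iff₀ hδ, mul_comm]
        exact hcomp a b (by have := Finset.mem_range.1 ha; omega) hb
      refine (Finset.sum_le_sum h2).trans ?_
      rw [Finset.sum_const, Finset.card_range, nsmul_eq_mul, ← mul_div_assoc, div_mul_eq_mul_div]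
      have hb' : (b : ℝ) ≤ L := by exact_mod_cast hb.trans hj
      have := hu0 b
      push_cast
      gcongr
  -- the pointwise bound
  set D : ℕ → ℝ := fun a => C * (u a ^ 2 * (u a ^ d)⁻¹) * gradSq (cell (τ a)) f
  have hD0 : ∀ a, 0 ≤ D a := fun a => by
    have := gradSq_nonneg (cell (τ a)) f
    have := hu0 a
    positivity
  -- Since `f z = 0`, the value at `y` is a total variation along the chain; Cauchy–Schwarz squares
  -- the sum.
  have hpt : ∀ y ∈ cell (τ 0), f y ^ 2 ≤ (L + 1) * ∑ a ∈ Finset.range (j + 1), D a := by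
    intro y hy
    have h1 := dist_le_sum_of_chain f (by omega) (D := fun a => √(D a)) hadj (fun a ha y hy z hz => by
      rw [Real.dist_eq]
      exact Real.abs_le_sqrt (H M hM S hS f hf (τ a) (hτ a ha) y hy z hz)) hy hz
    rw [hfz, Real.dist_eq, sub_zero] at h1
    rw [← sq_abs]
    refine (pow_le_pow_left₀ (abs_nonneg _) h1 2).trans ?_
    refine (sq_sum_le_card_mul_sum_sq).trans ?_
    rw [Finset.card_range]
    simp only [Real.sq_sqrt (hD0 _)]
    have := Finset.sum_nonneg fun a (_ : a ∈ Finset.range (j + 1)) => hD0 a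
    push_cast
    gcongr
  have hsum0 := Finset.sum_nonneg fun a (_ : a ∈ Finset.range (j + 1)) => hD0 a
  refine (l2Sq_cell_le (hS (hτ 0 (Nat.zero_le _))) (by positivity) hpt).trans ?_
  set G := ∑ T' ∈ S.filter (Near ((L + 1) / δ) (τ 0)), gradSq (cell T') f
  have hterm : ∀ a ∈ Finset.range (j + 1),
      u 0 ^ d * D a ≤ C * (δ ^ d)⁻¹ * M.meshSize ^ 2 * G := by
    intro a ha
    have haj : a ≤ j := by have := Finset.mem_range.1 ha; omega
    have hG : gradSq (cell (τ a)) f ≤ G :=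
      Finset.single_le_sum (f := fun T => gradSq (cell T) f) (fun T _ => gradSq_nonneg _ _)
        (Finset.mem_filter.2 ⟨hτ a haj, hnear a haj⟩)
    have ha0 := hupos a haj
    have h1 : u 0 ^ d * (u a ^ d)⁻¹ ≤ (δ ^ d)⁻¹ := by
      rw [← div_eq_mul_inv, div_le_iff₀ (by positivity), ← div_eq_inv_mul, le_div_iff₀ (by positivity),
        mul_comm, ← mul_pow]
      exact pow_le_pow_left₀ (mul_nonneg hδ.le (hu0 0)) (hcomp 0 a (Nat.zero_le _) haj) d
    have h2 : u a ^ 2 ≤ M.meshSize ^ 2 :=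
      pow_le_pow_left₀ ha0.le (diam_cell_le_meshSize (hS (hτ a haj))) 2
    have hg0 := gradSq_nonneg (cell (τ a)) f
    have h00 := hu0 0
    calc u 0 ^ d * D a = C * (u 0 ^ d * (u a ^ d)⁻¹) * u a ^ 2 * gradSq (cell (τ a)) f := by
          simp only [D]; ring
      _ ≤ C * (δ ^ d)⁻¹ * M.meshSize ^ 2 * G := by gcongr
  have hG0 : 0 ≤ G := Finset.sum_nonneg fun T _ => gradSq_nonneg _ _
  have hB := (ballVol_pos d).le
  calc ballVol d * u 0 ^ d * ((L + 1) * ∑ a ∈ Finset.range (j + 1), D a)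
      = ballVol d * (L + 1) * ∑ a ∈ Finset.range (j + 1), u 0 ^ d * D a := by
        rw [← Finset.mul_sum]; ring
    _ ≤ ballVol d * (L + 1) * ∑ a ∈ Finset.range (j + 1), C * (δ ^ d)⁻¹ * M.meshSize ^ 2 * G := by
        exact mul_le_mul_of_nonneg_left (Finset.sum_le_sum hterm) (by positivity)
    _ = ballVol d * (L + 1) * ((j + 1) * (C * (δ ^ d)⁻¹ * M.meshSize ^ 2 * G)) := by
        rw [Finset.sum_const, Finset.card_range, nsmul_eq_mul]; push_cast; rfl
    _ ≤ ballVol d * (L + 1) * ((L + 1) * (C * (δ ^ d)⁻¹ * M.meshSize ^ 2 * G)) := by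
        gcongr
    _ = _ := by ring

open Classical in
/-- A Poincaré inequality on a subdomain in which every element is joined by a short chain to an
element with a zero. -/
lemma exists_poincare (d r : ℕ) (hd : 2 ≤ d) {σ : ℝ} (hσ : 0 < σ) (hσ1 : σ ≤ 1) (L : ℕ) :
    ∃ C > 0, ∀ M : Mesh d, M.ShapeRegular σ → ∀ S ⊆ M.elements, ∀ f ∈ pwPoly r S,
      (∀ T ∈ S, ∃ j ≤ L, ∃ τ : ℕ → Finset (Pt d), τ 0 = T ∧ (∀ a ≤ j, τ a ∈ S) ∧
        (∀ a < j, (τ a ∩ τ (a + 1)).card = d) ∧ ∃ z ∈ cell (τ j), f z = 0) →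
      l2Sq (subdomain S) f ≤ C * M.meshSize ^ 2 * gradSq (subdomain S) f := by
  obtain ⟨Q, hQ, C, hC, H⟩ := exists_l2Sq_le_of_chain d r hd hσ hσ1 L
  -- The summand 1 only makes the constant strictly positive, as `C` may be 0.
  refine ⟨C * (2 * Q ^ 2 / σ) ^ d + 1, by positivity, fun M hM S hS f hf hch => ?_⟩
  rw [l2Sq_subdomain hS hf, gradSq_subdomain hS hf]
  have h1 : ∀ T ∈ S, l2Sq (cell T) f ≤
      C * M.meshSize ^ 2 * ∑ T' ∈ S.filter (Near Q T), gradSq (cell T') f := by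
    intro T hT
    obtain ⟨j, hj, τ, rfl, h2, h3, h4⟩ := hch T hT
    exact H M hM S hS f hf j hj τ h2 h3 h4
  refine (Finset.sum_le_sum h1).trans ?_
  rw [← Finset.mul_sum]
  -- Interchanging the sums leaves, for each `T'`, the number of elements `T` to which it is near.
  have h2 : ∑ T ∈ S, ∑ T' ∈ S.filter (Near Q T), gradSq (cell T') f ≤
      (2 * Q ^ 2 / σ) ^ d * ∑ T' ∈ S, gradSq (cell T') f := by
    simp only [Finset.sum_filter]
    rw [Finset.sum_comm, Finset.mul_sum]
    refine Finset.sum_le_sum fun T' hT' => ?_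
    rw [← Finset.sum_filter, Finset.sum_const, nsmul_eq_mul]
    refine mul_le_mul_of_nonneg_right ?_ (gradSq_nonneg _ _)
    exact hM.card_near_le hσ (by omega) hQ (hS hT') ((Finset.filter_subset _ _).trans hS)
      fun T hT => (Finset.mem_filter.1 hT).2
  have h3 : 0 ≤ ∑ T' ∈ S, gradSq (cell T') f := Finset.sum_nonneg fun T _ => gradSq_nonneg _ _
  calc C * M.meshSize ^ 2 * ∑ T ∈ S, ∑ T' ∈ S.filter (Near Q T), gradSq (cell T') f
      ≤ C * M.meshSize ^ 2 * ((2 * Q ^ 2 / σ) ^ d * ∑ T' ∈ S, gradSq (cell T') f) := by gcongr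
    _ ≤ C * M.meshSize ^ 2 * ((2 * Q ^ 2 / σ) ^ d * ∑ T' ∈ S, gradSq (cell T') f) +
        M.meshSize ^ 2 * ∑ T' ∈ S, gradSq (cell T') f := le_add_of_nonneg_right (by positivity)
    _ = _ := by ring

/-! ### Comparison of nodal values -/

/-- There are `r` factors in all, each of modulus at most `r` since barycentric coordinates lie in
[0, 1] and `j ≤ r`. -/
lemma abs_basisFun_le {r : ℕ} {T : Finset (Pt d)} (hT : T ∈ M.elements)
    {α : Pt d →₀ ℕ} (hα : α ∈ M.nodes r) {y : Pt d} (hy : y ∈ cell T) :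
    |M.basisFun r α y| ≤ (r : ℝ) ^ r := by
  rw [basisFun, Finset.abs_prod]
  have h1 : ∀ x ∈ α.support, |∏ j ∈ Finset.range (α x),
      ((r : ℝ) * M.bary y x - (j : ℝ)) / ((j : ℝ) + 1)| ≤ (r : ℝ) ^ α x := by
    intro x hx
    rw [Finset.abs_prod]
    refine (Finset.prod_le_prod (g := fun _ => (r : ℝ)) (fun _ _ => abs_nonneg _)
      fun j hj => ?_).trans_eq (by rw [Finset.prod_const, Finset.card_range])
    have hjr : (j : ℝ) ≤ r := by
      have h2 := Finset.single_le_sum (f := fun x => α x) (fun _ _ => Nat.zero_le _) hx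
      rw [sum_of_mem_nodes hα] at h2
      exact_mod_cast (Finset.mem_range.1 hj).le.trans h2
    have hj0 : (0 : ℝ) ≤ j := Nat.cast_nonneg j
    rw [M.bary_eq_baryCoord hT hy, abs_div, abs_of_pos (show (0 : ℝ) < j + 1 by positivity)]
    have b0 := M.baryCoord_nonneg hT x hy
    have b1 := M.baryCoord_le_one hT x hy
    refine (div_le_self (abs_nonneg _) (by linarith)).trans ?_
    have hr0 : (0 : ℝ) ≤ r := Nat.cast_nonneg r
    rw [abs_le]
    constructor <;> nlinarith
  refine (Finset.prod_le_prod (fun _ _ => abs_nonneg _) h1).trans_eq ?_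
  rw [Finset.prod_pow_eq_pow_sum, sum_of_mem_nodes hα]

open Classical in
-- A node of `T` is determined by its `d + 1` multiplicities, each at most `r`.
lemma card_nodes_element_le {r : ℕ} {T : Finset (Pt d)} (hT : T ∈ M.elements) :
    ((M.nodes r).filter fun α => α.support ⊆ T).card ≤ (r + 1) ^ (d + 1) := by
  have : ((M.nodes r).filter fun α => α.support ⊆ T).card ≤
      (Fintype.piFinset fun _ : T => Finset.range (r + 1)).card := by
    refine Finset.card_le_card_of_injOn (fun α x => α x) (fun α hα => ?_) ?_
    · obtain ⟨h1, h2⟩ := Finset.mem_filter.1 hα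
      rw [Finset.mem_coe, Fintype.mem_piFinset]
      intro x
      rw [Finset.mem_range, Nat.lt_succ_iff, ← sum_of_mem_nodes h1]
      by_cases hx : (x : Pt d) ∈ α.support
      · exact Finset.single_le_sum (f := fun x => α x) (fun _ _ => Nat.zero_le _) hx
      · change α x ≤ _
        rw [Finsupp.notMem_support_iff.1 hx]; exact Nat.zero_le _
    · intro α hα β hβ e
      ext x
      by_cases hx : x ∈ T
      · exact congrFun e ⟨x, hx⟩
      · rw [Finsupp.notMem_support_iff.1 fun h => hx ((Finset.mem_filter.1 hα).2 h),
          Finsupp.notMem_support_iff.1 fun h => hx ((Finset.mem_filter.1 hβ).2 h)]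
  refine this.trans_eq ?_
  simp [(M.mem_elements.1 hT).2]

open Classical in
/-- Finite element functions with smaller nodal values on an element have a smaller `L²` norm on
it, up to a constant. -/
lemma exists_l2Sq_le_of_nodal (d r : ℕ) (hd : 1 ≤ d) (hr : 1 ≤ r) {σ : ℝ} (hσ : 0 < σ) :
    ∃ C ≥ 0, ∀ M : Mesh d, M.ShapeRegular σ → ∀ T ∈ M.elements,
      ∀ f ∈ M.femSpace r, ∀ g ∈ M.femSpace r, ∀ K ≥ (0 : ℝ),
      (∀ α ∈ M.dofs r, α.support ⊆ T → |f (nodePos r α)| ≤ K * |g (nodePos r α)|) →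
      l2Sq (cell T) f ≤ C * K ^ 2 * l2Sq (cell T) g := by
  obtain ⟨C, hC, H⟩ := exists_sup_le_l2Sq d r hd hσ
  obtain ⟨n, hn⟩ : ∃ n : ℝ, n = (((r + 1) ^ (d + 1) : ℕ) : ℝ) := ⟨_, rfl⟩
  have hB := (ballVol_pos d).le
  refine ⟨ballVol d * (n * (r : ℝ) ^ r) ^ 2 * C, by positivity,
    fun M hM T hT f hf g hg K hK hle => ?_⟩
  set h := Metric.diam (cell T)
  have hh : 0 < h := diam_cell_pos hd hT
  obtain ⟨G, hG⟩ : ∃ G, G = C * (h ^ d)⁻¹ * l2Sq (cell T) g := ⟨_, rfl⟩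
  have hG0 : 0 ≤ G := by rw [hG]; have := l2Sq_nonneg (cell T) g; positivity
  have hS : {T} ⊆ M.elements := by simpa using hT
  have hg' : ∀ y ∈ cell T, |g y| ≤ √G := fun y hy => Real.abs_le_sqrt
    (hG ▸ H M hM {T} hS g (femSpace_le_pwPoly hS hg) T (Finset.mem_singleton_self T) y hy)
  have hf' : ∀ y ∈ cell T, |f y| ≤ n * (r : ℝ) ^ r * (K * √G) := by
    intro y hy
    rw [femSpace_eq_sum hr hf, Finset.sum_apply]
    -- Only nodes carried by `T` contribute, so the number of terms is bounded independently of the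
    -- mesh.
    rw [← Finset.sum_filter_of_ne (p := fun α => α.support ⊆ T) fun α _ hne => by
      by_contra hs
      exact hne (by simp [basisFun_eq_zero hT hs hy])]
    refine (Finset.abs_sum_le_sum_abs _ _).trans ?_
    refine (Finset.sum_le_sum (g := fun _ => (r : ℝ) ^ r * (K * √G)) fun α hα => ?_).trans ?_
    · obtain ⟨h1, h2⟩ := Finset.mem_filter.1 hα
      have hα' := mem_nodes_of_mem_dofs h1
      rw [Pi.smul_apply, smul_eq_mul, abs_mul, mul_comm]
      have h3 := abs_basisFun_le hT hα' hy
      have h4 := hg' _ (nodePos_mem_cell hr hα' h2)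
      have h5 := hle α h1 h2
      exact mul_le_mul h3 (h5.trans (mul_le_mul_of_nonneg_left h4 hK)) (abs_nonneg _)
        (by positivity)
    · rw [Finset.sum_const, nsmul_eq_mul, mul_assoc]
      refine mul_le_mul_of_nonneg_right ?_ (by positivity)
      rw [hn]
      refine Nat.cast_le.2 (le_trans (Finset.card_le_card ?_) (card_nodes_element_le (r := r) hT))
      exact Finset.filter_subset_filter _ fun α => mem_nodes_of_mem_dofs
  have hf2 : ∀ y ∈ cell T, f y ^ 2 ≤ (n * (r : ℝ) ^ r) ^ 2 * (K ^ 2 * G) := by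
    intro y hy
    rw [← sq_abs]
    refine (pow_le_pow_left₀ (abs_nonneg _) (hf' y hy) 2).trans_eq ?_
    rw [mul_pow, mul_pow K, Real.sq_sqrt hG0]
  refine (l2Sq_cell_le hT (by positivity) hf2).trans_eq ?_
  rw [hG]
  change ballVol d * h ^ d * _ = _
  field_simp

/-- A node is an internal degree of freedom only of subdomains which contain all elements around
it. -/
lemma ShapeRegular.mem_of_mem_innerDofs {σ : ℝ} (hM : M.ShapeRegular σ) (hσ : 0 < σ) (hd : 1 ≤ d)
    {r : ℕ} (hr : 1 ≤ r) {S : Finset (Finset (Pt d))} (hS : S ⊆ M.elements) {α : Pt d →₀ ℕ}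
    (hα : α ∈ M.innerDofs r (subdomain S)) {T : Finset (Pt d)} (hT : T ∈ M.elements)
    (h : α.support ⊆ T) : T ∈ S := by
  classical
  by_contra hTS
  obtain ⟨C, hC, H⟩ := exists_sup_le_l2Sq d r hd hσ
  have hn := mem_nodes_of_mem_dofs (mem_dofs_of_mem_innerDofs hα)
  have hsupp : tsupport (M.basisFun r α) ⊆ closure (subdomain S) := (Finset.mem_filter.1 hα).2
  have hS1 : {T} ⊆ M.elements := by simpa using hT
  have h1 := H M hM {T} hS1 _ (femSpace_le_pwPoly hS1 (basisFun_mem_femSpace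
    (mem_dofs_of_mem_innerDofs hα))) T (Finset.mem_singleton_self T) _ (nodePos_mem_cell hr hn h)
  have h2 : l2Sq (cell T) (M.basisFun r α) = 0 := by
    -- An element outside `S` meets the closed subdomain in a null set, so the basis function
    -- vanishes almost everywhere on it. The sup bound then contradicts the value 1 at the node.
    refine integral_eq_zero_of_ae ?_
    have hnull : volume (cell T ∩ ⋃ T' ∈ S, cell T') = 0 := by
      rw [Set.inter_iUnion₂]
      exact (measure_biUnion_null_iff S.countable_toSet).2 fun T' hT' =>
        M.volume_cell_inter hT (hS hT') fun e => hTS (e ▸ hT')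
    have hae : ∀ᵐ x ∂(volume : Measure (Pt d)), x ∉ cell T ∩ ⋃ T' ∈ S, cell T' :=
      measure_eq_zero_iff_ae_notMem.1 hnull
    filter_upwards [ae_restrict_of_ae hae, ae_restrict_mem (isClosed_cell T).measurableSet]
      with x hx hxT
    have : x ∉ tsupport (M.basisFun r α) := fun hx' => hx ⟨hxT, by
      rw [← closure_subdomain hS]; exact hsupp hx'⟩
    simp [image_eq_zero_of_notMem_tsupport this]
  rw [h2, mul_zero, M.basisFun_node hr hn hn, if_pos rfl] at h1
  norm_num at h1

lemma multiplicity_pos {r : ℕ} {N : ℕ} {S : Fin N → Finset (Finset (Pt d))} {i : Fin N}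
    {α : Pt d →₀ ℕ} (hα : α ∈ M.innerDofs r (subdomain (S i))) : 0 < M.multiplicity r S α := by
  classical
  exact Finset.card_pos.2 ⟨i, by simpa using hα⟩

/-- Every subdomain counted in the multiplicity contains one fixed element carrying the node, and at
most Λ_c subdomains contain that element. -/
lemma ShapeRegular.multiplicity_le {σ : ℝ} (hM : M.ShapeRegular σ) (hσ : 0 < σ) (hd : 1 ≤ d)
    {r : ℕ} (hr : 1 ≤ r) {N : ℕ} {S : Fin N → Finset (Finset (Pt d))} (hS : ∀ i, S i ⊆ M.elements)
    {α : Pt d →₀ ℕ} (hα : α ∈ M.nodes r) : M.multiplicity r S α ≤ M.overlapNumber S := by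
  classical
  obtain ⟨T, hT, hs⟩ := exists_element_of_mem_nodes hα
  refine le_trans ?_ (Finset.le_sup (f := fun T => (Finset.univ.filter fun i => T ∈ S i).card) hT)
  refine Finset.card_le_card fun i hi => ?_
  simp only [Finset.mem_filter, Finset.mem_univ, true_and] at hi ⊢
  exact hM.mem_of_mem_innerDofs hσ hd hr (hS i) hi hT hs

end Mesh

end ElementEstimates

section Forms

open Mesh

variable {d : ℕ} {M : Mesh d} {r : ℕ} {S : Finset (Finset (Pt d))}
  {A : Pt d → Matrix (Fin d) (Fin d) ℝ} {n : Pt d → ℝ} {aMax nMin k : ℝ} {u v u' : Pt d → ℝ}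

/-! ### The bilinear forms on piecewise polynomials -/

lemma measurable_gradient (u : Pt d → ℝ) : Measurable (gradient u) :=
  (LinearIsometryEquiv.continuous _).measurable.comp (measurable_fderiv ℝ u)

lemma measurable_formA_integrand (hA : ∀ i j, Measurable fun x => A x i j) (u v : Pt d → ℝ) :
    Measurable fun x => (A x).mulVec (gradient u x).ofLp ⬝ᵥ (gradient v x).ofLp := by
  have h : ∀ (u : Pt d → ℝ) (i : Fin d), Measurable fun x => (gradient u x).ofLp i := fun u i =>
    (EuclideanSpace.proj (𝕜 := ℝ) i).continuous.measurable.comp (measurable_gradient u)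
  simp only [Matrix.mulVec, dotProduct]
  exact Finset.measurable_sum _ fun i _ => (Finset.measurable_sum _ fun j _ =>
    (hA i j).mul (h u j)).mul (h v i)

lemma ae_subdomain_of_ae_domain (hS : S ⊆ M.elements) {p : Pt d → Prop}
    (h : ∀ᵐ x ∂volume.restrict M.domain, p x) : ∀ᵐ x ∂volume.restrict (subdomain S), p x :=
  ae_restrict_of_ae_restrict_of_subset (subdomain_subset_domain hS) h

lemma differentiableAt_of_mem_pwPoly (hu : u ∈ pwPoly r S) {T : Finset (Pt d)} (hT : T ∈ S)
    {x : Pt d} (hx : x ∈ interior (cell T)) : DifferentiableAt ℝ u x := by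
  obtain ⟨P, hP, e⟩ := hu T hT
  have : u =ᶠ[nhds x] P := by
    filter_upwards [mem_interior_iff_mem_nhds.1 hx] with y hy using e hy
  exact this.differentiableAt_iff.2
    ((contDiff_of_mem_polySpace hP (m := 1)).differentiable one_ne_zero x)

lemma ae_differentiableAt_of_mem_pwPoly (hS : S ⊆ M.elements) (hu : u ∈ pwPoly r S) :
    ∀ᵐ x ∂volume.restrict (subdomain S), DifferentiableAt ℝ u x := by
  rw [ae_subdomain_iff hS]
  intro T hT
  filter_upwards [ae_mem_interior_cell T] with x hx using differentiableAt_of_mem_pwPoly hu hT hx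

lemma mulVec_dotProduct_comm {B : Matrix (Fin d) (Fin d) ℝ} (hB : B.IsSymm) (ξ η : Fin d → ℝ) :
    B.mulVec ξ ⬝ᵥ η = B.mulVec η ⬝ᵥ ξ := by
  conv_lhs => rw [← hB.eq, Matrix.mulVec_transpose, ← Matrix.dotProduct_mulVec, dotProduct_comm]

/-- Positivity at ξ + η and ξ - η, with symmetry, bounds the mixed term. The result dominates the
integrand of `formA` by an integrable function. -/
lemma abs_mulVec_dotProduct_le {B : Matrix (Fin d) (Fin d) ℝ} (hB : B.IsSymm)
    (h : ∀ ξ : Pt d, ‖ξ‖ ^ 2 ≤ B.mulVec ξ.ofLp ⬝ᵥ ξ.ofLp ∧ B.mulVec ξ.ofLp ⬝ᵥ ξ.ofLp ≤ aMax * ‖ξ‖ ^ 2)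
    (ξ η : Pt d) : |B.mulVec ξ.ofLp ⬝ᵥ η.ofLp| ≤ aMax * ‖ξ‖ ^ 2 + aMax * ‖η‖ ^ 2 := by
  have h1 := (h (ξ + η)).1
  have h2 := (h (ξ - η)).1
  have hc := mulVec_dotProduct_comm hB ξ.ofLp η.ofLp
  simp only [WithLp.ofLp_add, WithLp.ofLp_sub, Matrix.mulVec_add, Matrix.mulVec_sub, add_dotProduct,
    sub_dotProduct, dotProduct_add, dotProduct_sub] at h1 h2
  have h3 := h ξ
  have h4 := h η
  have := sq_nonneg ‖ξ‖
  have := sq_nonneg ‖η‖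
  have := sq_nonneg ‖ξ + η‖
  have := sq_nonneg ‖ξ - η‖
  rw [abs_le]
  constructor <;> linarith

lemma integrableOn_formA (hS : S ⊆ M.elements) (hc : CoefficientBounds M.domain A n aMax nMin)
    (hu : u ∈ pwPoly r S) (hv : v ∈ pwPoly r S) :
    IntegrableOn (fun x => (A x).mulVec (gradient u x).ofLp ⬝ᵥ (gradient v x).ofLp)
      (subdomain S) := by
  have hg : ∀ {u}, u ∈ pwPoly r S → IntegrableOn (fun x => ‖gradient u x‖ ^ 2) (subdomain S) :=
    fun hu => (integrable_subdomain_iff hS).2 fun T hT => integrableOn_cell_gradSq hu hT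
  refine (((hg hu).const_mul aMax).add ((hg hv).const_mul aMax)).mono'
    (measurable_formA_integrand hc.measurable_A u v).aestronglyMeasurable ?_
  filter_upwards [ae_subdomain_of_ae_domain hS hc.symm_A, ae_subdomain_of_ae_domain hS hc.bounds_A]
    with x h1 h2
  exact abs_mulVec_dotProduct_le h1 h2 _ _

lemma integrableOn_formN (hS : S ⊆ M.elements) (hc : CoefficientBounds M.domain A n aMax nMin)
    (hu : u ∈ pwPoly r S) (hv : v ∈ pwPoly r S) :
    IntegrableOn (fun x => n x * u x * v x) (subdomain S) := by
  have hn := ae_subdomain_of_ae_domain hS hc.bounds_n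
  rw [ae_subdomain_iff hS] at hn
  rw [integrable_subdomain_iff hS]
  intro T hT
  have hm : ∀ {u}, u ∈ pwPoly r S → AEStronglyMeasurable u (volume.restrict (cell T)) := by
    intro u hu
    obtain ⟨P, hP, e⟩ := hu T hT
    refine (contDiff_of_mem_polySpace hP (m := 0)).continuous.aestronglyMeasurable.congr ?_
    filter_upwards [ae_restrict_mem (isClosed_cell T).measurableSet] with x hx using (e hx).symm
  refine ((integrableOn_cell_sq hu hT).add (integrableOn_cell_sq hv hT)).mono'
    ((hc.measurable_n.aestronglyMeasurable.mul (hm hu)).mul (hm hv)) ?_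
  filter_upwards [hn T hT] with x hx
  have h0 := hc.nMin_pos
  rw [Real.norm_eq_abs, mul_assoc, abs_mul, abs_of_pos (h0.trans_le hx.1), abs_mul]
  have h1 : |u x| * |v x| ≤ u x ^ 2 + v x ^ 2 := by
    rw [← sq_abs (u x), ← sq_abs (v x)]
    nlinarith [sq_nonneg (|u x| - |v x|), sq_nonneg (|u x|), sq_nonneg (|v x|)]
  have h2 := mul_nonneg (abs_nonneg (u x)) (abs_nonneg (v x))
  simp only [Pi.add_apply]
  nlinarith [hx.2]

lemma formA_add_left (hS : S ⊆ M.elements) (hc : CoefficientBounds M.domain A n aMax nMin)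
    (hu : u ∈ pwPoly r S) (hu' : u' ∈ pwPoly r S) (hv : v ∈ pwPoly r S) :
    formA A (subdomain S) (u + u') v = formA A (subdomain S) u v + formA A (subdomain S) u' v := by
  rw [formA, formA, formA,
    ← integral_add (integrableOn_formA hS hc hu hv) (integrableOn_formA hS hc hu' hv)]
  refine integral_congr_ae ?_
  filter_upwards [ae_differentiableAt_of_mem_pwPoly hS hu,
    ae_differentiableAt_of_mem_pwPoly hS hu'] with x h1 h2
  rw [gradient_add_apply h1 h2, WithLp.ofLp_add, Matrix.mulVec_add, add_dotProduct]

lemma formA_smul_left (hS : S ⊆ M.elements) (c : ℝ) (hu : u ∈ pwPoly r S) :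
    formA A (subdomain S) (c • u) v = c * formA A (subdomain S) u v := by
  rw [formA, formA, ← integral_const_mul]
  refine integral_congr_ae ?_
  filter_upwards [ae_differentiableAt_of_mem_pwPoly hS hu] with x h1
  rw [gradient_smul_apply c h1, WithLp.ofLp_smul, Matrix.mulVec_smul, smul_dotProduct, smul_eq_mul]

lemma formA_comm (hS : S ⊆ M.elements) (hc : CoefficientBounds M.domain A n aMax nMin)
    (u v : Pt d → ℝ) : formA A (subdomain S) u v = formA A (subdomain S) v u := by
  refine integral_congr_ae ?_
  filter_upwards [ae_subdomain_of_ae_domain hS hc.symm_A] with x h1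
  exact mulVec_dotProduct_comm h1 _ _

lemma formN_add_left (hS : S ⊆ M.elements) (hc : CoefficientBounds M.domain A n aMax nMin)
    (hu : u ∈ pwPoly r S) (hu' : u' ∈ pwPoly r S) (hv : v ∈ pwPoly r S) :
    formN n (subdomain S) (u + u') v = formN n (subdomain S) u v + formN n (subdomain S) u' v := by
  rw [formN, formN, formN,
    ← integral_add (integrableOn_formN hS hc hu hv) (integrableOn_formN hS hc hu' hv)]
  refine integral_congr_ae (Filter.Eventually.of_forall fun x => ?_)
  simp only [Pi.add_apply]; ring

lemma formN_smul_left (Ω' : Set (Pt d)) (c : ℝ) :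
    formN n Ω' (c • u) v = c * formN n Ω' u v := by
  rw [formN, formN, ← integral_const_mul]
  refine integral_congr_ae (Filter.Eventually.of_forall fun x => ?_)
  simp only [Pi.smul_apply, smul_eq_mul]; ring

lemma formN_comm (Ω' : Set (Pt d)) (u v : Pt d → ℝ) : formN n Ω' u v = formN n Ω' v u := by
  refine integral_congr_ae (Filter.Eventually.of_forall fun x => ?_)
  simp only; ring

lemma integrableOn_subdomain_gradSq (hS : S ⊆ M.elements) (hu : u ∈ pwPoly r S) :
    IntegrableOn (fun x => ‖gradient u x‖ ^ 2) (subdomain S) :=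
  (integrable_subdomain_iff hS).2 fun _ hT => integrableOn_cell_gradSq hu hT

lemma integrableOn_subdomain_sq (hS : S ⊆ M.elements) (hu : u ∈ pwPoly r S) :
    IntegrableOn (fun x => u x ^ 2) (subdomain S) :=
  (integrable_subdomain_iff hS).2 fun _ hT => integrableOn_cell_sq hu hT

lemma gradSq_le_formA (hS : S ⊆ M.elements) (hc : CoefficientBounds M.domain A n aMax nMin)
    (hu : u ∈ pwPoly r S) : gradSq (subdomain S) u ≤ formA A (subdomain S) u u := by
  refine integral_mono_ae (integrableOn_subdomain_gradSq hS hu) (integrableOn_formA hS hc hu hu) ?_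
  filter_upwards [ae_subdomain_of_ae_domain hS hc.bounds_A] with x h using (h _).1

lemma formA_le_gradSq (hS : S ⊆ M.elements) (hc : CoefficientBounds M.domain A n aMax nMin)
    (hu : u ∈ pwPoly r S) : formA A (subdomain S) u u ≤ aMax * gradSq (subdomain S) u := by
  rw [gradSq, ← integral_const_mul]
  refine integral_mono_ae (integrableOn_formA hS hc hu hu)
    ((integrableOn_subdomain_gradSq hS hu).const_mul aMax) ?_
  filter_upwards [ae_subdomain_of_ae_domain hS hc.bounds_A] with x h using (h _).2

lemma formN_le_l2Sq (hS : S ⊆ M.elements) (hc : CoefficientBounds M.domain A n aMax nMin)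
    (hu : u ∈ pwPoly r S) : formN n (subdomain S) u u ≤ l2Sq (subdomain S) u := by
  refine integral_mono_ae (integrableOn_formN hS hc hu hu) (integrableOn_subdomain_sq hS hu) ?_
  filter_upwards [ae_subdomain_of_ae_domain hS hc.bounds_n] with x h
  rw [mul_assoc, ← sq]
  exact mul_le_of_le_one_left (sq_nonneg _) h.2

lemma l2Sq_le_formN (hS : S ⊆ M.elements) (hc : CoefficientBounds M.domain A n aMax nMin)
    (hu : u ∈ pwPoly r S) : nMin * l2Sq (subdomain S) u ≤ formN n (subdomain S) u u := by
  rw [l2Sq, ← integral_const_mul]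
  refine integral_mono_ae ((integrableOn_subdomain_sq hS hu).const_mul nMin)
    (integrableOn_formN hS hc hu hu) ?_
  filter_upwards [ae_subdomain_of_ae_domain hS hc.bounds_n] with x h
  rw [mul_assoc, ← sq]
  exact mul_le_mul_of_nonneg_right h.1 (sq_nonneg _)

lemma formA_self_nonneg (hS : S ⊆ M.elements) (hc : CoefficientBounds M.domain A n aMax nMin)
    (hu : u ∈ pwPoly r S) : 0 ≤ formA A (subdomain S) u u :=
  (gradSq_nonneg _ _).trans (gradSq_le_formA hS hc hu)

lemma formN_self_nonneg (hS : S ⊆ M.elements) (hc : CoefficientBounds M.domain A n aMax nMin)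
    (hu : u ∈ pwPoly r S) : 0 ≤ formN n (subdomain S) u u :=
  (mul_nonneg hc.nMin_pos.le (l2Sq_nonneg _ _)).trans (l2Sq_le_formN hS hc hu)

/-- The form `∫ A ∇u · ∇v` as a bilinear form on a space of piecewise polynomials. -/
def bilinA (hS : S ⊆ M.elements) (hc : CoefficientBounds M.domain A n aMax nMin)
    (V : Submodule ℝ (Pt d → ℝ)) (hV : V ≤ pwPoly r S) : LinearMap.BilinForm ℝ V :=
  LinearMap.mk₂ ℝ (fun u v => formA A (subdomain S) u v)
    (fun u u' v => formA_add_left hS hc (hV u.2) (hV u'.2) (hV v.2))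
    (fun c u _ => formA_smul_left hS c (hV u.2))
    (fun u v v' => by
      rw [formA_comm hS hc, formA_comm hS hc u, formA_comm hS hc u]
      exact formA_add_left hS hc (hV v.2) (hV v'.2) (hV u.2))
    (fun c u v => by
      rw [formA_comm hS hc, formA_comm hS hc u]
      exact formA_smul_left hS c (hV v.2))

/-- The form `∫ n u v` as a bilinear form on a space of piecewise polynomials. -/
def bilinN (hS : S ⊆ M.elements) (hc : CoefficientBounds M.domain A n aMax nMin)
    (V : Submodule ℝ (Pt d → ℝ)) (hV : V ≤ pwPoly r S) : LinearMap.BilinForm ℝ V :=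
  LinearMap.mk₂ ℝ (fun u v => formN n (subdomain S) u v)
    (fun u u' v => formN_add_left hS hc (hV u.2) (hV u'.2) (hV v.2))
    (fun c _ _ => formN_smul_left _ c)
    (fun u v v' => by
      rw [formN_comm, formN_comm _ (u : Pt d → ℝ), formN_comm _ (u : Pt d → ℝ)]
      exact formN_add_left hS hc (hV v.2) (hV v'.2) (hV u.2))
    (fun c u v => by
      rw [formN_comm, formN_comm _ (u : Pt d → ℝ)]
      exact formN_smul_left _ c)

/-- Stability in `‖·‖_{1,k}` of operations that decrease nodal values. -/
lemma exists_inner1k_le_of_nodal (d r : ℕ) (hd : 1 ≤ d) (hr : 1 ≤ r) {σ : ℝ} (hσ : 0 < σ) :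
    ∃ C ≥ 0, ∀ M : Mesh d, M.ShapeRegular σ → ∀ S ⊆ M.elements,
      ∀ (A : Pt d → Matrix (Fin d) (Fin d) ℝ) (n : Pt d → ℝ) (aMax nMin : ℝ),
        CoefficientBounds M.domain A n aMax nMin →
      ∀ k Cinv : ℝ, 0 ≤ k → 0 ≤ Cinv → InverseEstimate M r k Cinv →
      ∀ f ∈ M.femSpace r, ∀ g ∈ M.femSpace r, ∀ K ≥ (0 : ℝ),
      (∀ α ∈ M.dofs r, |f (nodePos r α)| ≤ K * |g (nodePos r α)|) →
      inner1k A n k (subdomain S) (restrict (subdomain S) f) (restrict (subdomain S) f) ≤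
        C * K ^ 2 * (nMin⁻¹ * (aMax * Cinv ^ 2 + 1)) *
          inner1k A n k (subdomain S) (restrict (subdomain S) g) (restrict (subdomain S) g) := by
  obtain ⟨C, hC, H⟩ := exists_l2Sq_le_of_nodal d r hd hr hσ
  refine ⟨C, hC, fun M hM S hS A n aMax nMin hc k Cinv hk hCinv hinv f hf g hg K hK hle => ?_⟩
  have hmem : ∀ {f}, f ∈ M.femSpace r → restrict (subdomain S) f ∈ pwPoly r S := fun {f} hf =>
    restrictedSpace_le_pwPoly hS ⟨f, hf, rfl⟩
  set uf := restrict (subdomain S) f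
  set ug := restrict (subdomain S) g
  have l2 : ∀ f ∈ M.femSpace r,
      l2Sq (subdomain S) (restrict (subdomain S) f) = ∑ T ∈ S, l2Sq (cell T) f := fun f hf => by
    rw [l2Sq_subdomain hS (hmem hf)]
    exact Finset.sum_congr rfl fun T hT => l2Sq_congr (restrict_eqOn_cell hS hT f)
  -- The inverse estimate replaces the gradient of `f` by its L² norm, so only L² norms of `f` and
  -- `g` have to be compared.
  have h1 : gradSq (subdomain S) uf ≤ Cinv ^ 2 * k ^ 2 * l2Sq (subdomain S) uf := by
    rw [gradSq_subdomain hS (hmem hf), l2 f hf, Finset.mul_sum]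
    refine Finset.sum_le_sum fun T hT => ?_
    rw [gradSq_congr (restrict_eqOn_cell hS hT f)]
    have := pow_le_pow_left₀ (Real.sqrt_nonneg _) (hinv T (hS hT) f hf) 2
    rwa [mul_pow, mul_pow, Real.sq_sqrt (gradSq_nonneg _ _), Real.sq_sqrt (l2Sq_nonneg _ _)] at this
  have h2 : l2Sq (subdomain S) uf ≤ C * K ^ 2 * l2Sq (subdomain S) ug := by
    rw [l2 f hf, l2 g hg, Finset.mul_sum]
    exact Finset.sum_le_sum fun T hT => H M hM T (hS hT) f hf g hg K hK fun α hα _ => hle α hα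
  have h3 := formA_le_gradSq hS hc (hmem hf)
  have h4 := formN_le_l2Sq hS hc (hmem hf)
  have h5 := l2Sq_le_formN hS hc (hmem hg)
  have h6 := formA_self_nonneg hS hc (hmem hg)
  have ha : 0 ≤ aMax := zero_le_one.trans hc.one_le_aMax
  have hn := hc.nMin_pos
  have h7 : l2Sq (subdomain S) ug ≤ nMin⁻¹ * formN n (subdomain S) ug ug := by
    rwa [le_inv_mul_iff₀ hn]
  calc inner1k A n k (subdomain S) uf uf
      ≤ aMax * (Cinv ^ 2 * k ^ 2 * l2Sq (subdomain S) uf) + k ^ 2 * l2Sq (subdomain S) uf := by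
        rw [inner1k]
        gcongr
        exact h3.trans (by gcongr)
    _ = (aMax * Cinv ^ 2 + 1) * k ^ 2 * l2Sq (subdomain S) uf := by ring
    _ ≤ (aMax * Cinv ^ 2 + 1) * k ^ 2 *
          (C * K ^ 2 * (nMin⁻¹ * formN n (subdomain S) ug ug)) := by
        gcongr
        exact h2.trans (by gcongr)
    _ = C * K ^ 2 * (nMin⁻¹ * (aMax * Cinv ^ 2 + 1)) * (0 + k ^ 2 * formN n (subdomain S) ug ug) := by
        ring
    _ ≤ _ := by
        rw [inner1k]
        gcongr

/-- Coercivity from a Poincaré inequality on a scale that resolves the wave number. -/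
lemma coercive_of_poincare (hS : S ⊆ M.elements) (hc : CoefficientBounds M.domain A n aMax nMin)
    {C h : ℝ} (hC : 0 < C) (hkh : (k * h) ^ 2 ≤ (4 * C)⁻¹) (hu : u ∈ pwPoly r S)
    (hP : l2Sq (subdomain S) u ≤ C * h ^ 2 * gradSq (subdomain S) u) :
    (4 * C)⁻¹ * (h ^ 2)⁻¹ * l2Sq (subdomain S) u ≤ formB A n k (subdomain S) u u ∧
      inner1k A n k (subdomain S) u u ≤ 2 * formB A n k (subdomain S) u u := by
  have h1 := gradSq_le_formA hS hc hu
  have h2 := formN_le_l2Sq hS hc hu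
  set G := gradSq (subdomain S) u
  have hG : 0 ≤ G := gradSq_nonneg _ _
  have h3 : k ^ 2 * formN n (subdomain S) u u ≤ G / 4 := by
    calc k ^ 2 * formN n (subdomain S) u u ≤ k ^ 2 * (C * h ^ 2 * G) := by
          gcongr; exact h2.trans hP
      _ = C * (k * h) ^ 2 * G := by ring
      _ ≤ C * (4 * C)⁻¹ * G := by gcongr
      _ = G / 4 := by field_simp
  have h4 : (4 * C)⁻¹ * (h ^ 2)⁻¹ * l2Sq (subdomain S) u ≤ G / 4 := by
    calc (4 * C)⁻¹ * (h ^ 2)⁻¹ * l2Sq (subdomain S) u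
        ≤ (4 * C)⁻¹ * (h ^ 2)⁻¹ * (C * h ^ 2 * G) := by gcongr
      _ = ((h ^ 2)⁻¹ * h ^ 2) * (G / 4) := by field_simp
      -- An inequality rather than an equality, because `h = 0` is not excluded here.
      _ ≤ 1 * (G / 4) := by gcongr; exact inv_mul_le_one
      _ = G / 4 := one_mul _
  rw [formB, inner1k]
  constructor <;> linarith

end Forms

/-! ### Abstract generalised eigenvalue problems -/

section Abstract

variable {V : Type*} [AddCommGroup V] [Module ℝ V]

lemma sum_orthonormal_right {N : ℕ} {c : LinearMap.BilinForm ℝ V} {p : Fin N → V}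
    (hp : ∀ j j', c (p j) (p j') = if j = j' then 1 else 0) (s : Finset (Fin N)) (t : Fin N → ℝ)
    (i : Fin N) : c (∑ j ∈ s, t j • p j) (p i) = if i ∈ s then t i else 0 := by
  simp [map_sum, LinearMap.sum_apply, hp]

/-- Eigenvectors that are orthonormal for `c` and as many as the codimension of the kernel of `c`
span a complement of this kernel. -/
lemma sub_sum_mem_ker [FiniteDimensional ℝ V] {N : ℕ} {c : LinearMap.BilinForm ℝ V}
    {p : Fin N → V} (hp : ∀ j j', c (p j) (p j') = if j = j' then 1 else 0)
    (hN : N = Module.finrank ℝ V - Module.finrank ℝ (LinearMap.ker c)) (v : V) :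
    v - ∑ j, c v (p j) • p j ∈ LinearMap.ker c := by
  let Φ : V →ₗ[ℝ] (Fin N → ℝ) := LinearMap.pi fun j => c.flip (p j)
  have hΦ : ∀ v j, Φ v j = c v (p j) := fun _ _ => rfl
  have hsurj : LinearMap.range Φ = ⊤ := by
    rw [LinearMap.range_eq_top]
    intro t
    refine ⟨∑ j, t j • p j, funext fun i => ?_⟩
    rw [hΦ, sum_orthonormal_right hp]; simp
  have hle : LinearMap.ker c ≤ LinearMap.ker Φ := fun u hu => by
    rw [LinearMap.mem_ker] at hu ⊢
    ext j; rw [hΦ, hu]; rfl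
  have hdim := LinearMap.finrank_range_add_finrank_ker Φ
  rw [hsurj, finrank_top, Module.finrank_fin_fun] at hdim
  -- `Φ` is onto, so rank–nullity gives its kernel dimension dim V - N, which is that of `ker c`.
  -- The subtraction in `hN` does not truncate.
  have hker : LinearMap.ker c = LinearMap.ker Φ := by
    refine Submodule.eq_of_le_of_finrank_eq hle ?_
    have := Submodule.finrank_le (LinearMap.ker c)
    omega
  rw [hker, LinearMap.mem_ker]
  ext i
  rw [hΦ, map_sub, LinearMap.sub_apply, sum_orthonormal_right hp]; simp

lemma bilin_add_self {f : LinearMap.BilinForm ℝ V} (hf : ∀ u v, f u v = f v u) (x y : V) :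
    f (x + y) (x + y) = f x x + 2 * f x y + f y y := by
  simp only [map_add, LinearMap.add_apply, hf y x]; ring

/-- Young's inequality applied to `a` and `g` separately, since the difference `a - g` is
indefinite. -/
lemma neg_sub_apply_le {a g : LinearMap.BilinForm ℝ V} (ha : ∀ u, 0 ≤ a u u) (hg : ∀ u, 0 ≤ g u u)
    (ha' : ∀ u v, a u v = a v u) (hg' : ∀ u v, g u v = g v u) (q u : V) :
    -(a - g) q u ≤ (a + g) q q + (a + g) u u / 4 := by
  have h1 := ha (q + (1 / 2 : ℝ) • u)
  have h2 := hg (q - (1 / 2 : ℝ) • u)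
  simp only [map_add, map_sub, map_smul, LinearMap.add_apply, LinearMap.sub_apply,
    LinearMap.smul_apply, smul_eq_mul, ha' u q, hg' u q] at h1 h2 ⊢
  linarith

/-- The projection onto eigenvectors of `b(p, ·) = λ c(p, ·)`, where `b = a - g` is positive on the
kernel of `c`. -/
theorem eigenprojection_bounds [FiniteDimensional ℝ V] {a g c : LinearMap.BilinForm ℝ V}
    (ha : ∀ u, 0 ≤ a u u) (hg : ∀ u, 0 ≤ g u u) (hc : ∀ u, 0 ≤ c u u)
    (ha' : ∀ u v, a u v = a v u) (hg' : ∀ u v, g u v = g v u) (hc' : ∀ u v, c u v = c v u)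
    (hker : ∀ u, c u u = 0 → (a + g) u u ≤ 2 * (a - g) u u) {K₁ K₂ : ℝ} (hK₁ : 0 ≤ K₁)
    (hq : ∀ v, ∃ q, v - q ∈ LinearMap.ker c ∧ (a + g) q q ≤ K₁ * c v v)
    (hK₂ : ∀ v, c v v ≤ K₂ * (a + g) v v) {N : ℕ} {p : Fin N → V} {lam : Fin N → ℝ}
    (hp : ∀ j j', c (p j) (p j') = if j = j' then 1 else 0)
    (heig : ∀ j v, (a - g) (p j) v = lam j * c (p j) v) (hlam : Monotone lam)
    (hN : N = Module.finrank ℝ V - Module.finrank ℝ (LinearMap.ker c))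
    (m : ℕ) (hm : m < N) (hpos : 0 < lam ⟨m, hm⟩) (v w : V)
    (hw : w = v - ∑ j ∈ Finset.univ.filter (fun j : Fin N => (j : ℕ) < m), c v (p j) • p j) :
    0 ≤ (a - g) w w ∧ (a - g) w w ≤ (1 + 3 * K₁ * K₂) * (a + g) v v ∧
      c w w ≤ (lam ⟨m, hm⟩)⁻¹ * (a - g) w w := by
  set b := a - g
  set e := a + g
  have hb' : ∀ u v, b u v = b v u := fun u v => by
    simp only [b, LinearMap.sub_apply, ha' u v, hg' u v]
  set t : Fin N → ℝ := fun j => c v (p j)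
  set F := Finset.univ.filter fun j : Fin N => (j : ℕ) < m
  have hcker : ∀ u ∈ LinearMap.ker c, ∀ v, c u v = 0 := fun u hu v => by
    rw [LinearMap.mem_ker.1 hu]; rfl
  have hbker : ∀ u ∈ LinearMap.ker c, ∀ j, b (p j) u = 0 := fun u hu j => by
    rw [heig, hc', hcker u hu, mul_zero]
  -- expansions of the forms in terms of eigenvectors
  have cexp : ∀ (s : Finset (Fin N)), c (∑ j ∈ s, t j • p j) (∑ j ∈ s, t j • p j) =
      ∑ j ∈ s, t j ^ 2 := fun s => by
    rw [map_sum]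
    refine Finset.sum_congr rfl fun i hi => ?_
    rw [map_smul, sum_orthonormal_right hp, if_pos hi, smul_eq_mul, sq]
  have bexp : ∀ (s : Finset (Fin N)), b (∑ j ∈ s, t j • p j) (∑ j ∈ s, t j • p j) =
      ∑ j ∈ s, lam j * t j ^ 2 := fun s => by
    rw [map_sum]
    refine Finset.sum_congr rfl fun i hi => ?_
    rw [map_smul, hb', heig, hc', sum_orthonormal_right hp, if_pos hi, smul_eq_mul]; ring
  have bkerF : ∀ u ∈ LinearMap.ker c, ∀ s : Finset (Fin N), b (∑ j ∈ s, t j • p j) u = 0 :=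
    fun u hu s => by
      rw [map_sum, LinearMap.sum_apply]
      exact Finset.sum_eq_zero fun j _ => by
        rw [map_smul, LinearMap.smul_apply, hbker u hu, smul_zero]
  -- The splitting v = u + P + R is orthogonal for `c` and for `b`: the eigenvalue equation
  -- transfers `c`-orthogonality to `b`, also against the kernel.
  set P := ∑ j ∈ F, t j • p j
  set u := v - ∑ j, t j • p j
  have hu : u ∈ LinearMap.ker c := sub_sum_mem_ker hp hN v
  set R := ∑ j ∈ Fᶜ, t j • p j
  have hsum : ∑ j, t j • p j = P + R := (Finset.sum_add_sum_compl F _).symm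
  have hwR : w = u + R := by
    rw [hw]; simp only [u, hsum]; abel
  -- Indices start at 0: `F` holds the first `m` modes, and `lam ⟨m, hm⟩` is the smallest of the
  -- remaining eigenvalues.
  have hRlam : ∀ j ∈ Fᶜ, lam ⟨m, hm⟩ ≤ lam j := fun j hj => hlam <| by
    simp only [F, Finset.mem_compl, Finset.mem_filter, Finset.mem_univ, true_and, not_lt] at hj
    exact hj
  have he0 : ∀ v, 0 ≤ e v v := fun v => by
    simp only [e, LinearMap.add_apply]; exact add_nonneg (ha v) (hg v)
  have hu0 : 0 ≤ b u u := by
    have := hker u (hcker u hu u)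
    have := he0 u
    linarith
  have hbw : b w w = b u u + ∑ j ∈ Fᶜ, lam j * t j ^ 2 := by
    rw [hwR, bilin_add_self hb', hb' u R, bkerF u hu, bexp]
    ring
  have hcw : c w w = ∑ j ∈ Fᶜ, t j ^ 2 := by
    rw [hwR, bilin_add_self hc', hcker u hu, hcker u hu, cexp]
    ring
  have hle : lam ⟨m, hm⟩ * c w w ≤ b w w := by
    rw [hbw, hcw, Finset.mul_sum]
    refine le_trans ?_ (le_add_of_nonneg_left hu0)
    exact Finset.sum_le_sum fun j hj => mul_le_mul_of_nonneg_right (hRlam j hj) (sq_nonneg _)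
  refine ⟨(mul_nonneg hpos.le (hc w)).trans hle, ?_, by rwa [le_inv_mul_iff₀ hpos]⟩
  -- the upper bound
  have hv : v = w + P := by rw [hw]; abel
  have hbPR : b P R = 0 := by
    rw [map_sum]
    refine Finset.sum_eq_zero fun j hj => ?_
    rw [map_smul, hb', heig, hc', sum_orthonormal_right hp, if_neg (Finset.mem_compl.1 hj)]
    simp
  have hbPw : b P w = 0 := by rw [hwR, map_add, bkerF u hu, hbPR, add_zero]
  have hbv : b v v = b w w + b P P := by
    rw [hv, bilin_add_self hb', hb' w P, hbPw]
    ring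
  have hbe : b v v ≤ e v v := by
    simp only [b, e, LinearMap.add_apply, LinearMap.sub_apply]; linarith [hg v]
  have hcP : c P P ≤ c v v := by
    have h1 : c v v = c P P + ∑ j ∈ Fᶜ, t j ^ 2 := by
      have h2 : v = u + (P + R) := by rw [← hsum]; simp [u]
      rw [cexp, Finset.sum_add_sum_compl, ← cexp Finset.univ, hsum]
      conv_lhs => rw [h2]
      rw [bilin_add_self hc', hcker u hu, hcker u hu]
      ring
    rw [h1]
    exact le_add_of_nonneg_right (Finset.sum_nonneg fun _ _ => sq_nonneg _)
  -- It remains to bound b(P,P) from below, although the first eigenvalues may be negative. The part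
  -- `z` of `P` in the kernel is `b`-orthogonal to `P` and can be eliminated in favour of `q`.
  obtain ⟨q, hqk, hqle⟩ := hq P
  set z := P - q
  have hPz : b P z = 0 := bkerF z hqk F
  have hPq : P = q + z := by simp [z]
  have hqz : b q z = - b z z := by
    rw [hPq, map_add, LinearMap.add_apply] at hPz; linarith
  have hbPP : b P P = b q q - b z z := by
    have h1 : b P P = b P q + b P z := (congrArg (b P) hPq).trans (map_add _ _ _)
    have h2 : b q P = b q q + b q z := (congrArg (b q) hPq).trans (map_add _ _ _)
    rw [h1, hPz, add_zero, hb', h2, hqz]; ring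
  have hyoung : -b q z ≤ e q q + e z z / 4 := neg_sub_apply_le ha hg ha' hg' q z
  have hzz := hker z (hcker z hqk z)
  have hqq : -e q q ≤ b q q := by
    simp only [b, e, LinearMap.add_apply, LinearMap.sub_apply]; linarith [ha q]
  have h3 : e q q ≤ K₁ * (K₂ * e v v) := hqle.trans
    (mul_le_mul_of_nonneg_left (hcP.trans (hK₂ v)) hK₁)
  -- By `hqz`, `hyoung` and `hzz`, b(z,z) ≤ e(q,q) + b(z,z)/2, so b(z,z) ≤ 2e(q,q) and b(P,P) ≥
  -- -3e(q,q). This is the factor 3 in the bound.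
  nlinarith

end Abstract

section LocalProblem

open Mesh

variable {d : ℕ} {M : Mesh d} {r : ℕ}

/-! ### Nodal values at internal degrees of freedom -/

namespace Mesh

instance (M : Mesh d) (r : ℕ) (Ω' : Set (Pt d)) : FiniteDimensional ℝ (M.restrictedSpace r Ω') := by
  have h : {f | ∃ α ∈ M.dofs r, f = M.basisFun r α} = M.basisFun r '' (M.dofs r : Set _) := by
    ext f; simp [eq_comm]
  have : (M.femSpace r).FG := by
    rw [femSpace, h]
    exact Submodule.fg_span ((M.dofs r).finite_toSet.image _)
  exact Module.Finite.iff_fg.2 (this.map _)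

/-- The finite element function with prescribed values at the internal degrees of freedom of `Ω'`
and zero values at all others. -/
def nodalFun (M : Mesh d) (r : ℕ) (Ω' : Set (Pt d)) (t : (Pt d →₀ ℕ) → ℝ) : Pt d → ℝ :=
  ∑ α ∈ M.innerDofs r Ω', t α • M.basisFun r α

lemma nodalFun_mem_femSpace (Ω' : Set (Pt d)) (t : (Pt d →₀ ℕ) → ℝ) :
    M.nodalFun r Ω' t ∈ M.femSpace r :=
  sum_mem fun _ hα =>
    Submodule.smul_mem _ _ (basisFun_mem_femSpace (mem_dofs_of_mem_innerDofs hα))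

open Classical in
lemma nodalFun_node (hr : 1 ≤ r) (Ω' : Set (Pt d)) (t : (Pt d →₀ ℕ) → ℝ) {β : Pt d →₀ ℕ}
    (hβ : β ∈ M.nodes r) :
    M.nodalFun r Ω' t (nodePos r β) = if β ∈ M.innerDofs r Ω' then t β else 0 := by
  rw [nodalFun, Finset.sum_apply, ← Finset.sum_ite_eq']
  refine Finset.sum_congr rfl fun α hα => ?_
  rw [Pi.smul_apply, smul_eq_mul,
    M.basisFun_node hr (mem_nodes_of_mem_dofs (mem_dofs_of_mem_innerDofs hα)) hβ]
  simp

lemma restrict_node (hr : 1 ≤ r) {Ω' : Set (Pt d)} {α : Pt d →₀ ℕ} (hα : α ∈ M.innerDofs r Ω')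
    (f : Pt d → ℝ) : restrict Ω' f (nodePos r α) = f (nodePos r α) := by
  classical
  have hn := mem_nodes_of_mem_dofs (mem_dofs_of_mem_innerDofs hα)
  refine Set.indicator_of_mem ((Finset.mem_filter.1 hα).2 (subset_tsupport _ ?_)) f
  simp [M.basisFun_node hr hn hn]

lemma Xi_eq_restrict {N : ℕ} (S : Fin N → Finset (Finset (Pt d))) (i : Fin N) (v : Pt d → ℝ) :
    M.Xi r S i v = restrict (subdomain (S i)) (M.nodalFun r (subdomain (S i))
      fun α => 1 / (M.multiplicity r S α : ℝ) * v (nodePos r α)) := by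
  rw [Xi, nodalFun, map_sum]
  exact Finset.sum_congr rfl fun α _ => by rw [map_smul]

lemma Xi_mem_restrictedSpace {N : ℕ} (S : Fin N → Finset (Finset (Pt d))) (i : Fin N)
    (v : Pt d → ℝ) : M.Xi r S i v ∈ M.restrictedSpace r (subdomain (S i)) := by
  rw [Xi_eq_restrict]
  exact ⟨_, nodalFun_mem_femSpace _ _, rfl⟩

lemma Xi_eq_zero {N : ℕ} {S : Fin N → Finset (Finset (Pt d))} {i : Fin N} {v : Pt d → ℝ}
    (h : ∀ α ∈ M.innerDofs r (subdomain (S i)), v (nodePos r α) = 0) : M.Xi r S i v = 0 :=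
  Finset.sum_eq_zero fun α hα => by rw [h α hα, mul_zero, zero_smul]

lemma Xi_node (hr : 1 ≤ r) {N : ℕ} {S : Fin N → Finset (Finset (Pt d))} {i : Fin N}
    {α : Pt d →₀ ℕ} (hα : α ∈ M.innerDofs r (subdomain (S i))) (v : Pt d → ℝ) :
    M.Xi r S i v (nodePos r α) = 1 / (M.multiplicity r S α : ℝ) * v (nodePos r α) := by
  classical
  rw [Xi_eq_restrict, restrict_node hr hα,
    nodalFun_node hr _ _ (mem_nodes_of_mem_dofs (mem_dofs_of_mem_innerDofs hα)), if_pos hα]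

/-- The operator `Ξ_i` as a linear map on the local space. -/
def XiLin (M : Mesh d) (r : ℕ) {N : ℕ} (S : Fin N → Finset (Finset (Pt d))) (i : Fin N) :
    localSpace M r S i →ₗ[ℝ] localSpace M r S i where
  toFun v := ⟨M.Xi r S i v, Xi_mem_restrictedSpace S i v⟩
  map_add' u v := by
    ext1
    simp [Xi, mul_add, add_smul, Finset.sum_add_distrib]
  map_smul' c u := by
    ext1
    simp [Xi, Finset.smul_sum, smul_smul, mul_left_comm]

/-- Because `k` and `nMin` are positive, the mass part of the energy forces `Ξ_i v` to vanish on
each element, in particular at the node, where its value is a positive multiple of that of `v`. -/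
lemma ShapeRegular.node_eq_zero_of_Xi {σ : ℝ} (hM : M.ShapeRegular σ) (hσ : 0 < σ) (hd : 1 ≤ d)
    (hr : 1 ≤ r) {N : ℕ} {S : Fin N → Finset (Finset (Pt d))} {i : Fin N} (hS : S i ⊆ M.elements)
    {A : Pt d → Matrix (Fin d) (Fin d) ℝ} {n : Pt d → ℝ} {aMax nMin k : ℝ}
    (hc : CoefficientBounds M.domain A n aMax nMin) (hk : 0 < k) {v : Pt d → ℝ}
    (h : cLoc M r S i A n k v v = 0) {α : Pt d →₀ ℕ}
    (hα : α ∈ M.innerDofs r (subdomain (S i))) : v (nodePos r α) = 0 := by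
  have hX : M.Xi r S i v ∈ pwPoly r (S i) :=
    restrictedSpace_le_pwPoly hS (Xi_mem_restrictedSpace S i v)
  have h1 := formA_self_nonneg hS hc hX
  have h2 := formN_self_nonneg hS hc hX
  have h3 := l2Sq_le_formN hS hc hX
  have h4 := l2Sq_nonneg (subdomain (S i)) (M.Xi r S i v)
  have hk2 : 0 < k ^ 2 := by positivity
  rw [cLoc, inner1k] at h
  have h5 : formN n (subdomain (S i)) (M.Xi r S i v) (M.Xi r S i v) = 0 := by nlinarith
  have h6 : l2Sq (subdomain (S i)) (M.Xi r S i v) = 0 := by nlinarith [hc.nMin_pos]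
  rw [l2Sq_subdomain hS hX, Finset.sum_eq_zero_iff_of_nonneg fun _ _ => l2Sq_nonneg _ _] at h6
  have hn := mem_nodes_of_mem_dofs (mem_dofs_of_mem_innerDofs hα)
  obtain ⟨T, hT, hs⟩ := exists_element_of_mem_nodes hn
  have hTS := hM.mem_of_mem_innerDofs hσ hd hr hS hα hT hs
  obtain ⟨C, -, H⟩ := exists_sup_le_l2Sq d r hd hσ
  have h7 := H M hM (S i) hS _ hX T hTS _ (nodePos_mem_cell hr hn hs)
  rw [h6 T hTS, mul_zero, Xi_node hr hα] at h7
  have h8 := pow_eq_zero_iff (two_ne_zero) |>.1 (le_antisymm h7 (sq_nonneg _))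
  have hμ := multiplicity_pos hα
  refine (mul_eq_zero.1 h8).resolve_left ?_
  positivity

open Classical in
lemma exists_chain_of_layerBound (hr : 1 ≤ r) {S : Finset (Finset (Pt d))} (hS : S ⊆ M.elements)
    {L : ℕ} (hL : M.LayerBound r S L) {v : Pt d → ℝ} (hv : v ∈ M.restrictedSpace r (subdomain S))
    (h0 : ∀ α ∈ M.innerDofs r (subdomain S), v (nodePos r α) = 0) :
    ∀ T ∈ S, ∃ j ≤ L, ∃ τ : ℕ → Finset (Pt d), τ 0 = T ∧ (∀ a ≤ j, τ a ∈ S) ∧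
      (∀ a < j, (τ a ∩ τ (a + 1)).card = d) ∧ ∃ z ∈ cell (τ j), v z = 0 := by
  intro T hT
  obtain ⟨j, hj, τ, h1, h2, h3, α, hα, hs, hor⟩ := hL T hT
  have hz := nodePos_mem_cell hr hα hs
  refine ⟨j, hj, τ, h1, h2, fun a ha => by convert h3 a ha, nodePos r α, hz, ?_⟩
  rcases hor with h | h
  · exact h0 α h
  · obtain ⟨f, hf, rfl⟩ := hv
    rw [restrict_eqOn_cell hS (h2 j le_rfl) f hz]
    -- Ω is open, so a node on its frontier is not a degree of freedom.
    refine femSpace_node_eq_zero hr hf hα fun hd' => ?_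
    have h4 : nodePos r α ∈ M.domain := (Finset.mem_filter.1 hd').2
    exact h.2 (by rw [domain, interior_interior]; exact h4)

lemma ShapeRegular.mono {σ σ' : ℝ} (hM : M.ShapeRegular σ) (h : σ' ≤ σ) : M.ShapeRegular σ' := by
  intro T hT
  obtain ⟨x, hx⟩ := hM T hT
  have := Metric.diam_nonneg (s := cell T)
  exact ⟨x, (Metric.closedBall_subset_closedBall (by gcongr)).trans hx⟩

lemma ShapeRegular.abs_node_le_overlap_mul {σ : ℝ} (hM : M.ShapeRegular σ) (hσ : 0 < σ) (hd : 1 ≤ d)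
    (hr : 1 ≤ r) {N : ℕ} {S : Fin N → Finset (Finset (Pt d))} (hS : ∀ i, S i ⊆ M.elements)
    {i : Fin N} {α : Pt d →₀ ℕ} (hα : α ∈ M.innerDofs r (subdomain (S i))) (x : ℝ) :
    |x| ≤ (M.overlapNumber S : ℝ) * |1 / (M.multiplicity r S α : ℝ) * x| := by
  have hμ : (0 : ℝ) < M.multiplicity r S α := by exact_mod_cast multiplicity_pos hα
  have hle : (M.multiplicity r S α : ℝ) ≤ M.overlapNumber S := by
    exact_mod_cast hM.multiplicity_le hσ hd hr hS
      (mem_nodes_of_mem_dofs (mem_dofs_of_mem_innerDofs hα))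
  rw [abs_mul, abs_of_pos (by positivity : 0 < 1 / (M.multiplicity r S α : ℝ)), ← mul_assoc]
  refine le_mul_of_one_le_left (abs_nonneg _) ?_
  rw [mul_one_div, one_le_div hμ]
  exact hle

lemma abs_inv_multiplicity_mul_le {N : ℕ} {S : Fin N → Finset (Finset (Pt d))} {i : Fin N}
    {α : Pt d →₀ ℕ} (hα : α ∈ M.innerDofs r (subdomain (S i))) (x : ℝ) :
    |1 / (M.multiplicity r S α : ℝ) * x| ≤ |x| := by
  have hμ : (1 : ℝ) ≤ M.multiplicity r S α := by exact_mod_cast multiplicity_pos hα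
  rw [abs_mul, abs_of_pos (by positivity : 0 < 1 / (M.multiplicity r S α : ℝ))]
  refine mul_le_of_le_one_left (abs_nonneg _) ?_
  rw [div_le_one (by positivity)]
  exact hμ

end Mesh

/-! ### The local eigenvalue problem -/

section Local

variable {N : ℕ} {S : Fin N → Finset (Finset (Pt d))} {i : Fin N}
  {A : Pt d → Matrix (Fin d) (Fin d) ℝ} {n : Pt d → ℝ} {aMax nMin k : ℝ}

lemma localSpace_le_pwPoly (hS : S i ⊆ M.elements) : localSpace M r S i ≤ pwPoly r (S i) :=
  restrictedSpace_le_pwPoly hS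

instance : FiniteDimensional ℝ (localSpace M r S i) :=
  inferInstanceAs (FiniteDimensional ℝ (M.restrictedSpace r (subdomain (S i))))

/-- The form `c_i` as a bilinear form on the local space. -/
def bilinC (hS : S i ⊆ M.elements) (hc : CoefficientBounds M.domain A n aMax nMin) (k : ℝ) :
    LinearMap.BilinForm ℝ (localSpace M r S i) :=
  (bilinA hS hc _ (localSpace_le_pwPoly hS) +
    k ^ 2 • bilinN hS hc _ (localSpace_le_pwPoly hS)).compl₁₂ (XiLin M r S i) (XiLin M r S i)

lemma bilinC_apply (hS : S i ⊆ M.elements) (hc : CoefficientBounds M.domain A n aMax nMin)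
    (u v : localSpace M r S i) : bilinC hS hc k u v = cLoc M r S i A n k u v := rfl

/-- `kerC` is a set of functions on ℝ^d, and `Set.finrank` measures its span. It is already a
subspace, the image of the kernel of the bilinear form. -/
lemma numFinite_eq (hS : S i ⊆ M.elements) (hc : CoefficientBounds M.domain A n aMax nMin) :
    numFinite M r S i A n k = Module.finrank ℝ (localSpace M r S i) -
      Module.finrank ℝ (LinearMap.ker (bilinC (r := r) hS hc k)) := by
  have h : kerC M r S i A n k =
      ((LinearMap.ker (bilinC (r := r) hS hc k)).map (localSpace M r S i).subtype : Set _) := by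
    ext v
    constructor
    · rintro ⟨hv, h⟩
      refine ⟨⟨v, hv⟩, LinearMap.mem_ker.2 ?_, rfl⟩
      ext1 w
      rw [bilinC_apply]
      exact h w w.2
    · rintro ⟨u, hu, rfl⟩
      refine ⟨u.2, fun w hw => ?_⟩
      have h1 := bilinC_apply (k := k) hS hc u ⟨w, hw⟩
      rw [LinearMap.mem_ker.1 hu] at h1
      exact h1.symm
  rw [numFinite, h, Set.finrank, Submodule.span_eq, Submodule.finrank_map_subtype_eq]

lemma mem_ker_bilinC (hS : S i ⊆ M.elements) (hc : CoefficientBounds M.domain A n aMax nMin)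
    {v : localSpace M r S i}
    (h : ∀ α ∈ M.innerDofs r (subdomain (S i)), v.1 (nodePos r α) = 0) :
    v ∈ LinearMap.ker (bilinC hS hc k) := by
  have hX : XiLin M r S i v = 0 := Subtype.ext (Xi_eq_zero h)
  rw [LinearMap.mem_ker]
  ext1 u
  rw [bilinC, LinearMap.compl₁₂_apply, hX, map_zero, LinearMap.zero_apply, LinearMap.zero_apply]

/-- `q` keeps the values of `v` at internal degrees of freedom. Those of `Ξ_i v` are smaller by the
factor 1/μ ≥ 1/Λ_c, so nodal stability applies with K = Λ_c. -/
lemma exists_nodal_part (hr : 1 ≤ r) {σ : ℝ} (hM : M.ShapeRegular σ) (hσ : 0 < σ) (hd : 1 ≤ d)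
    (hS : ∀ i, S i ⊆ M.elements) {C β : ℝ}
    (hst : ∀ f ∈ M.femSpace r, ∀ g ∈ M.femSpace r, ∀ K ≥ (0 : ℝ),
      (∀ α ∈ M.dofs r, |f (nodePos r α)| ≤ K * |g (nodePos r α)|) →
      inner1k A n k (subdomain (S i)) (restrict (subdomain (S i)) f) (restrict (subdomain (S i)) f)
        ≤ C * K ^ 2 * β * inner1k A n k (subdomain (S i)) (restrict (subdomain (S i)) g)
          (restrict (subdomain (S i)) g)) (v : Pt d → ℝ) :
    ∃ q ∈ localSpace M r S i, (∀ α ∈ M.innerDofs r (subdomain (S i)),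
      v (nodePos r α) - q (nodePos r α) = 0) ∧
      inner1k A n k (subdomain (S i)) q q ≤
        C * (M.overlapNumber S : ℝ) ^ 2 * β * cLoc M r S i A n k v v := by
  refine ⟨restrict (subdomain (S i)) (M.nodalFun r (subdomain (S i)) fun α => v (nodePos r α)),
    ⟨_, nodalFun_mem_femSpace _ _, rfl⟩, fun α hα => ?_, ?_⟩
  · rw [restrict_node hr hα, nodalFun_node hr _ _
      (mem_nodes_of_mem_dofs (mem_dofs_of_mem_innerDofs hα)), if_pos hα, sub_self]
  · rw [cLoc, Xi_eq_restrict]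
    refine hst _ (nodalFun_mem_femSpace _ _) _ (nodalFun_mem_femSpace _ _) _
      (Nat.cast_nonneg _) fun α hα => ?_
    rw [nodalFun_node hr _ _ (mem_nodes_of_mem_dofs hα),
      nodalFun_node hr _ _ (mem_nodes_of_mem_dofs hα)]
    split_ifs with h
    · exact hM.abs_node_le_overlap_mul hσ hd hr hS h _
    · simp

/-- The weights 1/μ are at most 1, so nodal stability applies with K = 1. -/
lemma cLoc_le_inner1k (hr : 1 ≤ r) {C β : ℝ}
    (hst : ∀ f ∈ M.femSpace r, ∀ g ∈ M.femSpace r, ∀ K ≥ (0 : ℝ),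
      (∀ α ∈ M.dofs r, |f (nodePos r α)| ≤ K * |g (nodePos r α)|) →
      inner1k A n k (subdomain (S i)) (restrict (subdomain (S i)) f) (restrict (subdomain (S i)) f)
        ≤ C * K ^ 2 * β * inner1k A n k (subdomain (S i)) (restrict (subdomain (S i)) g)
          (restrict (subdomain (S i)) g)) {v : Pt d → ℝ} (hv : v ∈ localSpace M r S i) :
    cLoc M r S i A n k v v ≤ C * β * inner1k A n k (subdomain (S i)) v v := by
  obtain ⟨f, hf, rfl⟩ := hv
  rw [cLoc, Xi_eq_restrict]
  have := hst _ (nodalFun_mem_femSpace (subdomain (S i)) fun α =>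
      1 / (M.multiplicity r S α : ℝ) * restrict (subdomain (S i)) f (nodePos r α))
    f hf 1 zero_le_one fun α hα => by
      rw [nodalFun_node hr _ _ (mem_nodes_of_mem_dofs hα), one_mul]
      split_ifs with h
      · rw [restrict_node hr h]
        exact abs_inv_multiplicity_mul_le h _
      · simp
  rwa [one_pow, mul_one] at this

/-- A nonzero `c_i` requires an internal degree of freedom, whose multiplicity is positive and at
most Λ_c. This allows the summand 1 in 1 + 3 K₁ K₂ to be absorbed by C_*. -/
lemma one_le_overlapNumber (hr : 1 ≤ r) {σ : ℝ} (hM : M.ShapeRegular σ) (hσ : 0 < σ) (hd : 1 ≤ d)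
    (hS : ∀ i, S i ⊆ M.elements) {v : Pt d → ℝ} (hv : cLoc M r S i A n k v v ≠ 0) :
    1 ≤ M.overlapNumber S := by
  have hne : ∃ α, α ∈ M.innerDofs r (subdomain (S i)) := by
    by_contra! hempty
    refine hv ?_
    rw [cLoc, Xi_eq_zero fun α hα => absurd hα (hempty α)]
    simp [inner1k, formA, formN, gradient_zero_fun]
  obtain ⟨α, hα⟩ := hne
  exact (multiplicity_pos hα).trans_le (hM.multiplicity_le hσ hd hr hS
    (mem_nodes_of_mem_dofs (mem_dofs_of_mem_innerDofs hα)))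

/-- With γ = n_min⁻¹ (a_max C_inv² + 2), the right-hand side is (1 + 3C²) Λ_c² γ² a_max C_inv², and
each of Λ_c, γ and a_max C_inv² is at least 1. -/
lemma projection_constant_le {C Cinv : ℝ} {Lam : ℕ} (hLam : 1 ≤ Lam) (haMax : 1 ≤ aMax)
    (hn0 : 0 < nMin) (hn1 : nMin ≤ 1) (hCinv : 1 ≤ Cinv) :
    1 + 3 * (C * (Lam : ℝ) ^ 2 * (nMin⁻¹ * (aMax * Cinv ^ 2 + 1))) *
        (C * (nMin⁻¹ * (aMax * Cinv ^ 2 + 1))) ≤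
      (1 + 3 * C ^ 2) * aMax * nMin⁻¹ * Cstar Lam aMax nMin Cinv := by
  have hΛ : (1 : ℝ) ≤ Lam := by exact_mod_cast hLam
  have hn1' : 1 ≤ nMin⁻¹ := (one_le_inv₀ hn0).2 hn1
  have haC : 1 ≤ aMax * Cinv ^ 2 := one_le_mul_of_one_le_of_one_le haMax (one_le_pow₀ hCinv)
  obtain ⟨β, hβ⟩ : ∃ β, β = nMin⁻¹ * (aMax * Cinv ^ 2 + 1) := ⟨_, rfl⟩
  obtain ⟨γ, hγ⟩ : ∃ γ, γ = nMin⁻¹ * (aMax * Cinv ^ 2 + 2) := ⟨_, rfl⟩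
  have hβ0 : 0 ≤ β := by rw [hβ]; positivity
  have hβγ : β ≤ γ := by rw [hβ, hγ]; gcongr; norm_num
  have hγ1 : 1 ≤ γ := by
    rw [hγ]; exact one_le_mul_of_one_le_of_one_le hn1' (by linarith)
  rw [← hβ]
  have h5 : (1 : ℝ) ≤ (Lam : ℝ) ^ 2 * γ ^ 2 :=
    one_le_mul_of_one_le_of_one_le (one_le_pow₀ hΛ) (one_le_pow₀ hγ1)
  have h6 : β ^ 2 ≤ γ ^ 2 := pow_le_pow_left₀ hβ0 hβγ 2
  calc 1 + 3 * (C * (Lam : ℝ) ^ 2 * β) * (C * β) = 1 + 3 * C ^ 2 * ((Lam : ℝ) ^ 2 * β ^ 2) := by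
        ring
    _ ≤ (Lam : ℝ) ^ 2 * γ ^ 2 + 3 * C ^ 2 * ((Lam : ℝ) ^ 2 * γ ^ 2) := by gcongr
    _ = (1 + 3 * C ^ 2) * ((Lam : ℝ) ^ 2 * γ ^ 2) := by ring
    _ ≤ (1 + 3 * C ^ 2) * ((Lam : ℝ) ^ 2 * γ ^ 2) * (aMax * Cinv ^ 2) :=
        le_mul_of_one_le_right (by positivity) haC
    _ = _ := by rw [hγ, Cstar, Ceig]; ring

/-- The bounds for the projection onto eigenfunctions, from positivity of `b_i` on `ker c_i` and
the stability of nodal truncation. -/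
lemma localProjection_bounds (hr : 1 ≤ r) {σ : ℝ} (hM : M.ShapeRegular σ) (hσ : 0 < σ) (hd : 1 ≤ d)
    (hS : ∀ i, S i ⊆ M.elements) (hc : CoefficientBounds M.domain A n aMax nMin)
    (hcoer : ∀ v ∈ localSpace M r S i, cLoc M r S i A n k v v = 0 →
      inner1k A n k (subdomain (S i)) v v ≤ 2 * bLoc S i A n k v v) {C β : ℝ} (hC : 0 ≤ C)
    (hβ : 0 ≤ β)
    (hst : ∀ f ∈ M.femSpace r, ∀ g ∈ M.femSpace r, ∀ K ≥ (0 : ℝ),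
      (∀ α ∈ M.dofs r, |f (nodePos r α)| ≤ K * |g (nodePos r α)|) →
      inner1k A n k (subdomain (S i)) (restrict (subdomain (S i)) f) (restrict (subdomain (S i)) f)
        ≤ C * K ^ 2 * β * inner1k A n k (subdomain (S i)) (restrict (subdomain (S i)) g)
          (restrict (subdomain (S i)) g))
    {p : Fin (numFinite M r S i A n k) → Pt d → ℝ} {lam : Fin (numFinite M r S i A n k) → ℝ}
    (hp : IsEigensystem M r S i A n k p lam) {m : ℕ} (hm : m < numFinite M r S i A n k)
    (hpos : 0 < lam ⟨m, hm⟩) {v w : Pt d → ℝ} (hv : v ∈ localSpace M r S i)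
    (hw : w = v - proj M r S i A n k p m v) :
    0 ≤ bLoc S i A n k w w ∧
      bLoc S i A n k w w ≤ (1 + 3 * (C * (M.overlapNumber S : ℝ) ^ 2 * β) * (C * β)) *
        inner1k A n k (subdomain (S i)) v v ∧
      cLoc M r S i A n k w w ≤ (lam ⟨m, hm⟩)⁻¹ * bLoc S i A n k w w := by
  have hpw := localSpace_le_pwPoly (r := r) (hS i)
  have hpsd : ∀ u ∈ localSpace M r S i, 0 ≤ inner1k A n k (subdomain (S i)) u u := fun u hu =>
    add_nonneg (formA_self_nonneg (hS i) hc (hpw hu))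
      (mul_nonneg (sq_nonneg _) (formN_self_nonneg (hS i) hc (hpw hu)))
  have hsymm : ∀ u v, inner1k A n k (subdomain (S i)) u v =
      inner1k A n k (subdomain (S i)) v u := fun u v => by
    rw [inner1k, inner1k, formA_comm (hS i) hc, formN_comm]
  obtain ⟨a, ha⟩ : ∃ a : LinearMap.BilinForm ℝ (localSpace M r S i),
      ∀ u v, a u v = formA A (subdomain (S i)) u v := ⟨bilinA (hS i) hc _ hpw, fun _ _ => rfl⟩
  obtain ⟨g, hg⟩ : ∃ g : LinearMap.BilinForm ℝ (localSpace M r S i),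
      ∀ u v, g u v = k ^ 2 * formN n (subdomain (S i)) u v :=
    ⟨k ^ 2 • bilinN (hS i) hc _ hpw, fun _ _ => rfl⟩
  have hag : ∀ u v, (a + g) u v = inner1k A n k (subdomain (S i)) u v := fun u v => by
    rw [LinearMap.add_apply, LinearMap.add_apply, ha, hg, inner1k]
  have hab : ∀ u v, (a - g) u v = bLoc S i A n k u v := fun u v => by
    rw [LinearMap.sub_apply, LinearMap.sub_apply, ha, hg, bLoc, formB]
  have hN := numFinite_eq (r := r) (k := k) (hS i) hc
  obtain ⟨c, hcc, hck, hN⟩ : ∃ c : LinearMap.BilinForm ℝ (localSpace M r S i),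
      (∀ u v, c u v = cLoc M r S i A n k u v) ∧
      (∀ v, (∀ α ∈ M.innerDofs r (subdomain (S i)), v.1 (nodePos r α) = 0) →
        v ∈ LinearMap.ker c) ∧
      numFinite M r S i A n k = Module.finrank ℝ (localSpace M r S i) -
        Module.finrank ℝ (LinearMap.ker c) :=
    ⟨bilinC (hS i) hc k, bilinC_apply (hS i) hc, fun v => mem_ker_bilinC (hS i) hc, hN⟩
  have hmain := eigenprojection_bounds (a := a) (g := g) (c := c)
    (fun u => by rw [ha]; exact formA_self_nonneg (hS i) hc (hpw u.2))
    (fun u => by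
      rw [hg]; exact mul_nonneg (sq_nonneg _) (formN_self_nonneg (hS i) hc (hpw u.2)))
    (fun u => by rw [hcc]; exact hpsd _ (Xi_mem_restrictedSpace S i u))
    (fun u v => by rw [ha, ha, formA_comm (hS i) hc])
    (fun u v => by rw [hg, hg, formN_comm])
    (fun u v => by rw [hcc, hcc, cLoc, hsymm, cLoc])
    (fun u hu => by
      rw [hcc] at hu
      rw [hag, hab]; exact hcoer u u.2 hu)
    (K₁ := C * (M.overlapNumber S : ℝ) ^ 2 * β) (K₂ := C * β) (by positivity)
    (fun v => by
      obtain ⟨q, hq, h1, h2⟩ := exists_nodal_part hr hM hσ hd hS hst v.1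
      refine ⟨⟨q, hq⟩, hck _ h1, ?_⟩
      rw [hag, hcc]; exact h2)
    (fun v => by rw [hag, hcc]; exact cLoc_le_inner1k hr hst v.2)
    (p := fun j => ⟨p j, hp.mem j⟩) (lam := lam)
    (fun j j' => by rw [hcc]; exact hp.orthonormal j j')
    (fun j v => by rw [hab, hcc]; exact hp.eigen j v v.2) hp.monotone
    hN m hm hpos ⟨v, hv⟩ ⟨w, by
      rw [hw]
      exact sub_mem hv (sum_mem fun j _ => Submodule.smul_mem _ _ (hp.mem j))⟩ (by
      ext1
      rw [Submodule.coe_sub, Submodule.coe_sum]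
      simp only [hcc, Submodule.coe_smul]
      exact hw)
  simp only [hab, hag, hcc] at hmain
  exact hmain

end Local

end LocalProblem

end HkGenEO

end

/-! ### Proof of the theorem. -/

open HkGenEO in
theorem theorem3p8 (d r : ℕ) (hd : d = 2 ∨ d = 3) (hr : 1 ≤ r) (CSR : ℝ) (hCSR : 0 < CSR)
    (L : ℕ) :
    ∃ C₁ > (0 : ℝ), ∃ C₂ > (0 : ℝ),
      ∀ (M : Mesh d), M.ShapeRegular CSR →
      ∀ (A : Pt d → Matrix (Fin d) (Fin d) ℝ) (n : Pt d → ℝ) (aMax nMin : ℝ),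
        CoefficientBounds M.domain A n aMax nMin →
      ∀ (k Cinv : ℝ), 0 < k → 1 ≤ Cinv → InverseEstimate M r k Cinv →
      ∀ (N : ℕ) (S : Fin N → Finset (Finset (Pt d))), M.IsCover S →
      ∀ i : Fin N, M.LayerBound r (S i) L →
      (k * M.meshSize) ^ 2 ≤ C₁ →
        -- the property that characterises `C₁`
        (∀ v ∈ kerC M r S i A n k,
          C₁ * (M.meshSize ^ 2)⁻¹ * l2Sq (Mesh.subdomain (S i)) v ≤ bLoc S i A n k v v) ∧
        ∀ (p : Fin (numFinite M r S i A n k) → Pt d → ℝ)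
          (lam : Fin (numFinite M r S i A n k) → ℝ),
          IsEigensystem M r S i A n k p lam →
        ∀ (m : ℕ) (hm : m < numFinite M r S i A n k), 1 ≤ m → 0 < lam ⟨m, hm⟩ →
        ∀ v ∈ localSpace M r S i, ∀ w : Pt d → ℝ, w = v - proj M r S i A n k p m v →
          0 ≤ bLoc S i A n k w w ∧
          bLoc S i A n k w w ≤
            C₂ ^ 2 * aMax * nMin⁻¹ * Cstar (M.overlapNumber S) aMax nMin Cinv *
              norm1k A n k (Mesh.subdomain (S i)) v ^ 2 ∧
          cLoc M r S i A n k w w ≤ (lam ⟨m, hm⟩)⁻¹ * bLoc S i A n k w w := by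
  have hd2 : 2 ≤ d := by omega
  -- The comparison of diameters along chains needs a shape constant of at most 1; lowering it keeps
  -- the mesh shape regular.
  have hσ : 0 < min CSR 1 := lt_min hCSR one_pos
  obtain ⟨CP, hCP, HP⟩ := Mesh.exists_poincare d r hd2 hσ (min_le_right _ _) L
  obtain ⟨C₀, hC₀, H₀⟩ := exists_inner1k_le_of_nodal d r (by omega) hr hσ
  -- C₁ makes k² ∫ n v² at most a quarter of ‖∇v‖², and the square of C₂ is the factor from
  -- `projection_constant_le`.
  refine ⟨(4 * CP)⁻¹, by positivity, √(1 + 3 * C₀ ^ 2), by positivity, ?_⟩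
  intro M hM A n aMax nMin hc k Cinv hk hCinv hinv N S hcov i hL hkh
  replace hM := hM.mono (min_le_left CSR 1)
  have hS := hcov.1 i
  have hcoer : ∀ v ∈ localSpace M r S i, cLoc M r S i A n k v v = 0 →
      (4 * CP)⁻¹ * (M.meshSize ^ 2)⁻¹ * l2Sq (Mesh.subdomain (S i)) v ≤ bLoc S i A n k v v ∧
        inner1k A n k (Mesh.subdomain (S i)) v v ≤ 2 * bLoc S i A n k v v := by
    intro v hv h0
    have hvp := localSpace_le_pwPoly hS hv
    exact coercive_of_poincare hS hc hCP hkh hvp (HP M hM _ hS v hvp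
      (Mesh.exists_chain_of_layerBound hr hS hL hv fun α hα =>
        hM.node_eq_zero_of_Xi hσ (by omega) hr hS hc hk h0 hα))
  refine ⟨fun v hv => (hcoer v hv.1 (hv.2 v hv.1)).1, ?_⟩
  intro p lam hp m hm hm1 hpos v hv w hw
  have hn0 := hc.nMin_pos
  have ha0 := zero_le_one.trans hc.one_le_aMax
  have hst := H₀ M hM _ hS A n aMax nMin hc k Cinv hk.le (by linarith) hinv
  have hpsd : 0 ≤ inner1k A n k (Mesh.subdomain (S i)) v v :=
    add_nonneg (formA_self_nonneg hS hc (localSpace_le_pwPoly hS hv))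
      (mul_nonneg (sq_nonneg _) (formN_self_nonneg hS hc (localSpace_le_pwPoly hS hv)))
  obtain ⟨h1, h2, h3⟩ := localProjection_bounds hr hM hσ (by omega) hcov.1 hc
    (fun v hv h0 => (hcoer v hv h0).2) hC₀ (by positivity) hst hp hm hpos hv hw
  refine ⟨h1, h2.trans ?_, h3⟩
  rw [norm1k, Real.sq_sqrt hpsd, Real.sq_sqrt (by positivity)]
  refine mul_le_mul_of_nonneg_right (projection_constant_le ?_ hc.one_le_aMax hn0 hc.nMin_le_one
    hCinv) hpsd
  -- The eigenfunction `p ⟨m, hm⟩` has `c_i`-norm one, so `c_i` is not zero.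
  refine one_le_overlapNumber hr hM hσ (by omega) hcov.1 (i := i) (A := A) (n := n) (k := k)
    (v := p ⟨m, hm⟩) ?_
  rw [hp.orthonormal, if_pos rfl]
  exact one_ne_zero
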